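/- Let $\Omega\subset\mathbb{R}^2$ be a bounded polygonal domain, that is, a bounded connected nonempty open set whose boundary is a finite union of line segments and which near each boundary point $c$ coincides with an open sector with apex $c$ and aperture in $(0,2\pi)$. A corner is a point of $\partial\Omega$ near which $\partial\Omega$ is not straight. Let $\mathscr{P}$ be a finite collection of open disks with centres on $\partial\Omega$ that covers $\partial\Omega$, such that each corner is the centre of a disk of $\mathscr{P}$ and does not belong to the closure of any other disk of $\mathscr{P}$. For $D\in\mathscr{P}$ let $\chi_D\in C^\infty(\mathbb{R}^2;\mathbb{R})$ with $\operatorname{supp}\chi_D\subset D$ and $\sum_{D\in\mathscr{P}}\chi_D=1$ on $\partial\Omega$. Let $\sigma$ be arc length on $\partial\Omega$ and let $C^\infty(\partial\Omega)$ be the space of restrictions to $\partial\Omega$ of (real- or complex-valued) functions in $C^\infty(\mathbb{R}^2)$. Let $H^{1/2}(\partial\Omega)$ be the completion of $C^\infty(\partial\Omega)$ for the norm $$\|w\|_{H^{1/2}(\partial\Omega)}^2=\|w\|_{L^2(\partial\Omega)}^2+\int_{\partial\Omega}\int_{\partial\Omega}\frac{|w(x)-w(y)|^2}{|x-y|^2}\,d\sigma(x)\,d\sigma(y),$$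 and let $$\|v\|_{H^{-1/2}(\partial\Omega)}=\sup_{w\in H^{1/2}(\partial\Omega)\setminus\{0\}}\frac{\left|\int_{\partial\Omega}v\,w\,d\sigma\right|}{\|w\|_{H^{1/2}(\partial\Omega)}}$$ be the dual norm. Define $$\langle\mathscr{A}(u),v\rangle=\int_{\partial\Omega}\int_{\partial\Omega}\frac{u(y)\,v(x)}{\sqrt{|x-y|}}\,d\sigma(x)\,d\sigma(y).$$ **Proposition.** Let $D,D'\in\mathscr{P}$, and suppose that $D\neq D'$, or that $D=D'$ and $D$ is not centred at a corner of $\partial\Omega$. Then there is a constant $C<\infty$ such that for all $u,v\in C^\infty(\partial\Omega)$ the double integral defining $\langle\mathscr{A}(\chi_D u),\chi_{D'}v\rangle$ converges absolutely and $$|\langle\mathscr{A}(\chi_D u),\chi_{D'}v\rangle|\le C\,\|u\|_{L^2(\partial\Omega)}\,\|v\|_{H^{-1/2}(\partial\Omega)}.$$ -/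

import Mathlib

open MeasureTheory Set
open scoped ENNReal NNReal ContDiff

namespace RieszPolygon

/-- The Euclidean plane. -/
abbrev Plane : Type := EuclideanSpace ℝ (Fin 2)

/-! ### Polygonal domains and corners -/

/-- The open plane sector with apex `0`, consisting of the points with polar angle strictly
between `α` and `α + τ`. -/
def sector (α τ : ℝ) : Set Plane :=
  {x | ∃ t φ : ℝ, 0 < t ∧ φ ∈ Ioo α (α + τ) ∧ x = !₂[t * Real.cos φ, t * Real.sin φ]}

/-- A bounded polygonal domain: a bounded, connected (nonempty) open set, whose boundary is a
finite union of line segments and is Lipschitz, i.e. near each boundary point `c` the set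
coincides with a sector of apex `c` and aperture `τ ∈ (0, 2π)` (`τ = π` where the boundary is
straight).  Holes are allowed. -/
structure IsPolygonalDomain (Ω : Set Plane) : Prop where
  isOpen : IsOpen Ω
  isConnected : IsConnected Ω
  isBounded : Bornology.IsBounded Ω
  boundary_segments : ∃ S : Finset (Plane × Plane),
    frontier Ω = ⋃ s ∈ S, segment ℝ s.1 s.2
  locally_sector : ∀ c ∈ frontier Ω, ∃ r > 0, ∃ α : ℝ, ∃ τ ∈ Ioo 0 (2 * Real.pi),
    Ω ∩ Metric.ball c r = {x | x - c ∈ sector α τ} ∩ Metric.ball c r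

/-- A corner of the boundary: a boundary point near which the boundary is not straight. -/
def IsCorner (Ω : Set Plane) (c : Plane) : Prop :=
  c ∈ frontier Ω ∧ ∀ r > 0, ¬ Collinear ℝ (frontier Ω ∩ Metric.ball c r)

/-! ### Covers by disks and partitions of unity -/

/-- An open disk of the plane, given by its centre and its (positive) radius. -/
@[ext] structure Disk where
  centre : Plane
  radius : ℝ
  radius_pos : 0 < radius

/-- The set of points of an open disk. -/
def Disk.carrier (D : Disk) : Set Plane := Metric.ball D.centre D.radius

/-- A finite cover of the boundary by open disks centred on the boundary, such that each corner
is the centre of one disk and does not belong to the closure of any other disk. -/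
structure IsDiskCover (Ω : Set Plane) (P : Finset Disk) : Prop where
  centre_mem : ∀ D ∈ P, D.centre ∈ frontier Ω
  cover : frontier Ω ⊆ ⋃ D ∈ P, D.carrier
  corner : ∀ c, IsCorner Ω c →
    ∃ D ∈ P, D.centre = c ∧ ∀ D' ∈ P, D' ≠ D → c ∉ closure D'.carrier

/-- A smooth partition of unity on the boundary subordinate to a family of disks. -/
structure IsDiskPartition (Ω : Set Plane) (P : Finset Disk) (χ : Disk → Plane → ℝ) : Prop where
  smooth : ∀ D ∈ P, ContDiff ℝ ∞ (χ D)
  tsupport_subset : ∀ D ∈ P, tsupport (χ D) ⊆ D.carrier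
  sum_eq_one : ∀ x ∈ frontier Ω, ∑ D ∈ P, χ D x = 1

/-! ### Trace spaces -/

/-- Arc length on a subset of the plane (one-dimensional Hausdorff measure). -/
noncomputable def arcLength (Γ : Set Plane) : Measure Plane := (μH[1]).restrict Γ

variable {𝕜 : Type*} [RCLike 𝕜]

/-- The square of the Sobolev-Slobodeckii seminorm of order `1/2`:
`∫_{Γ × Γ} |w(x) - w(y)|² / |x - y|² dx dy`. -/
noncomputable def hHalfSeminormSq (Γ : Set Plane) (w : Plane → 𝕜) : ℝ≥0∞ :=
  ∫⁻ p, ‖w p.1 - w p.2‖ₑ ^ 2 / edist p.1 p.2 ^ 2 ∂((arcLength Γ).prod (arcLength Γ))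

/-- The `H^{1/2}(Γ)` norm. -/
noncomputable def hHalfNorm (Γ : Set Plane) (w : Plane → 𝕜) : ℝ≥0∞ :=
  (eLpNorm w 2 (arcLength Γ) ^ 2 + hHalfSeminormSq Γ w) ^ (1 / 2 : ℝ)

/-- Membership in `H^{1/2}(Γ)`, the completion of the restrictions to `Γ` of smooth functions for
the norm `hHalfNorm`, realised as a space of functions: the limits, in this norm, of restrictions
of smooth functions. -/
def MemHHalf (Γ : Set Plane) (w : Plane → 𝕜) : Prop :=
  AEStronglyMeasurable w (arcLength Γ) ∧
    ∀ ε : ℝ≥0∞, 0 < ε → ∃ φ : Plane → 𝕜, ContDiff ℝ ∞ φ ∧ hHalfNorm Γ (w - φ) < ε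

/-- The dual norm of a function `v` on `Γ`: the supremum of `|⟨v, w⟩_Γ| / ‖w‖_{H^{1/2}(Γ)}`
over the nonzero `w ∈ H^{1/2}(Γ)`.  For `Γ = ∂Ω` this is the `H^{-1/2}(∂Ω)` norm. -/
noncomputable def hMinusHalfNorm (Γ : Set Plane) (v : Plane → 𝕜) : ℝ≥0∞ :=
  ⨆ (w : Plane → 𝕜) (_ : MemHHalf Γ w) (_ : hHalfNorm Γ w ≠ 0),
    ‖∫ x, v x * w x ∂(arcLength Γ)‖ₑ / hHalfNorm Γ w

/-! ### The Riesz potential -/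

/-- The integrand `u(y) v(x) / √|x - y|` at the pair `p = (x, y)`. -/
noncomputable def rieszIntegrand (u v : Plane → 𝕜) (p : Plane × Plane) : 𝕜 :=
  (Real.sqrt (dist p.1 p.2))⁻¹ • (u p.2 * v p.1)

/-- The pairing `⟨𝒜(u), v⟩_Γ = ∫_{Γ × Γ} u(y) v(x) / √|x - y| dσ(x) dσ(y)`. -/
noncomputable def rieszPairing (Γ : Set Plane) (u v : Plane → 𝕜) : 𝕜 :=
  ∫ p, rieszIntegrand u v p ∂((arcLength Γ).prod (arcLength Γ))

end RieszPolygon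

namespace RieszPolygon

/-! By duality it suffices to bound `χ D' • 𝒜(χ D • u)` in `H^{1/2}(∂Ω)` by the `L²` norm of `u`.
Pairs of points at distance at least `δ` cost only an `L²` bound, which is Schur's test, so the
seminorm can be estimated near each boundary point `p` and the estimates glued by compactness
(`exists_gagliardo_le_of_local`). If `p` is outside the support of `χ D'`, the function vanishes
near `p`. If `p` is outside the support of `χ D`, the kernel is Lipschitz between a neighbourhood of
`p` and the source. If `p` lies in both supports, the hypothesis on the disks says that `p` is not a
corner (`IsDiskCover.not_isCorner`), so `∂Ω` lies on a line near `p`; the far part of the source is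
again harmless, and the near part gives a convolution on `ℝ`.

On the line, the Fourier transform of the kernel is `O(|ξ|^{-1/2})`
(`IsRieszKernel.norm_fourier_sq_le`), while the Gagliardo seminorm is controlled by `∫ |ξ| |𝓕 W|²`.
Plancherel then gives the half derivative.

All of this is done for regularized kernels, with constants depending only on the bounds in
`IsRieszKernel`. Their potentials are smooth, hence admissible test functions for the dual norm, and
the singular pairing is recovered by dominated convergence
(`IsPolygonalDomain.tendsto_regularized_pairing`). -/

/-! ### Plancherel's theorem -/

open scoped FourierTransform in
/-- **Plancherel's theorem** for the Fourier integral of functions in `L¹ ∩ L²`. -/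
theorem lintegral_enorm_fourier_sq {f : ℝ → ℂ} (hf : Integrable f) (hf2 : MemLp f 2) :
    ∫⁻ ξ, ‖𝓕 f ξ‖ₑ ^ 2 = ∫⁻ x, ‖f x‖ₑ ^ 2 := by
  set F : Lp ℂ 2 (volume : Measure ℝ) := hf2.toLp f
  have hcont : Continuous (𝓕 f) := VectorFourier.fourierIntegral_continuous
    Real.continuous_fourierChar (by exact continuous_inner) hf
  -- The Fourier integral and the `L²` transform agree as distributions: both pair with a test
  -- function `G` to `∫ 𝓕 G • f`.
  have hae : ∀ᵐ ξ, 𝓕 f ξ = (𝓕 F : Lp ℂ 2 (volume : Measure ℝ)) ξ := by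
    refine ae_eq_of_integral_contDiff_smul_eq hcont.locallyIntegrable
      ((Lp.memLp _).locallyIntegrable (by norm_num)) fun g hg hgc => ?_
    have hgc' : HasCompactSupport (fun x => (g x : ℂ)) :=
      hgc.comp_left (g := fun t : ℝ => (t : ℂ)) (by simp)
    let G : SchwartzMap ℝ ℂ := hgc'.toSchwartzMap (Complex.ofRealCLM.contDiff.comp hg)
    have hG : ∀ x, G x = g x := fun x => rfl
    have h1 := congrArg (fun T => T G) (Lp.fourier_toTemperedDistribution_eq F)
    simp only [TemperedDistribution.fourier_apply, Lp.toTemperedDistribution_apply] at h1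
    have h2 : ∫ x, 𝓕 G x • F x = ∫ x, (𝓕 (G : ℝ → ℂ)) x • f x := by
      refine integral_congr_ae ?_
      filter_upwards [hf2.coeFn_toLp] with x hx
      rw [hx, SchwartzMap.fourier_coe]
    rw [h2] at h1
    have h3 : ∫ x, (𝓕 (G : ℝ → ℂ)) x • f x = ∫ x, G x • 𝓕 f x := by
      have := VectorFourier.integral_fourierIntegral_smul_eq_flip (μ := volume) (ν := volume)
        (L := innerₗ ℝ) Real.continuous_fourierChar (by exact continuous_inner)
        (G.integrable (μ := volume)) hf
      rw [flip_innerₗ] at this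
      exact this
    rw [h3] at h1
    simpa [hG] using h1
  have hn : eLpNorm (𝓕 F : Lp ℂ 2 (volume : Measure ℝ)) 2 volume = eLpNorm f 2 volume := by
    rw [← Lp.enorm_def, ← eLpNorm_congr_ae hf2.coeFn_toLp, ← Lp.enorm_def]
    simp only [enorm_eq_nnnorm]
    congr 1
    exact NNReal.eq (Lp.norm_fourier_eq F)
  rw [← eLpNorm_congr_ae hae] at hn
  have key : ∀ h : ℝ → ℂ, eLpNorm h 2 volume ^ 2 = ∫⁻ x, ‖h x‖ₑ ^ 2 := fun h => by
    have := eLpNorm_nnreal_pow_eq_lintegral (f := h) (μ := volume) (p := 2) (by norm_num)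
    simpa using this
  rw [← key, ← key, hn]

/-! ### One-dimensional integrals -/

theorem lintegral_comp_abs (F : ℝ → ℝ≥0∞) :
    ∫⁻ x, F |x| = 2 * ∫⁻ x in Ioi (0 : ℝ), F x := by
  have h1 : ∫⁻ x in Ioi (0 : ℝ), F |x| = ∫⁻ x in Ioi (0 : ℝ), F x :=
    setLIntegral_congr_fun measurableSet_Ioi fun x hx => by simp only [abs_of_pos (mem_Ioi.1 hx)]
  have h2 : ∫⁻ x in Iio (0 : ℝ), F |x| = ∫⁻ x in Ioi (0 : ℝ), F |x| := by
    have := (Measure.measurePreserving_neg (volume : Measure ℝ)).setLIntegral_comp_preimage_emb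
      (MeasurableEquiv.neg ℝ).measurableEmbedding (fun x => F |x|) (Ioi 0)
    simpa using this
  rw [← lintegral_add_compl (fun x => F |x|) (measurableSet_Ioi (a := (0 : ℝ))), compl_Ioi,
    setLIntegral_congr Iio_ae_eq_Iic.symm, h2, h1, two_mul]

theorem lintegral_inv_sqrt_abs {a : ℝ} (ha : 0 ≤ a) :
    ∫⁻ x, (Iic a).indicator (fun t => ENNReal.ofReal (√t)⁻¹) |x| = ENNReal.ofReal (4 * √a) := by
  rw [lintegral_comp_abs, lintegral_indicator measurableSet_Iic,
    Measure.restrict_restrict measurableSet_Iic, Iic_inter_Ioi]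
  have hi : IntegrableOn (fun t : ℝ => t ^ (-(1 / 2) : ℝ)) (Ioc 0 a) := by
    rw [← intervalIntegrable_iff_integrableOn_Ioc_of_le ha]
    exact intervalIntegral.intervalIntegrable_rpow' (by norm_num)
  have e : ∀ t ∈ Ioc 0 a, ENNReal.ofReal (√t)⁻¹ = ENNReal.ofReal (t ^ (-(1 / 2) : ℝ)) := by
    intro t ht
    rw [Real.rpow_neg ht.1.le, Real.sqrt_eq_rpow]
  rw [setLIntegral_congr_fun measurableSet_Ioc e, ← ofReal_integral_eq_lintegral_ofReal hi,
    ← intervalIntegral.integral_of_le ha, integral_rpow (by norm_num)]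
  · rw [← ENNReal.ofReal_ofNat 2, ← ENNReal.ofReal_mul (by norm_num)]
    congr 1
    rw [Real.sqrt_eq_rpow, Real.zero_rpow (by norm_num)]
    norm_num
    ring
  · filter_upwards [ae_restrict_mem measurableSet_Ioc] with t ht
    exact Real.rpow_nonneg ht.1.le _

theorem lintegral_rpow_abs_gt {a p : ℝ} (ha : 0 < a) (hp : p < -1) :
    ∫⁻ x, (Ioi a).indicator (fun t => ENNReal.ofReal (t ^ p)) |x| =
      ENNReal.ofReal (2 * (-a ^ (p + 1) / (p + 1))) := by
  rw [lintegral_comp_abs, lintegral_indicator measurableSet_Ioi,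
    Measure.restrict_restrict measurableSet_Ioi, Ioi_inter_Ioi, max_eq_left ha.le,
    ← ofReal_integral_eq_lintegral_ofReal (integrableOn_Ioi_rpow_of_lt hp ha),
    integral_Ioi_rpow_of_lt hp ha, ← ENNReal.ofReal_ofNat 2, ← ENNReal.ofReal_mul (by norm_num)]
  filter_upwards [ae_restrict_mem measurableSet_Ioi] with t ht
  exact Real.rpow_nonneg (ha.trans ht).le _

/-! ### Kernels of Riesz type -/

/-- Regularized radial kernels which are, uniformly, at most as singular as `r ↦ r ^ (-1/2)`. -/
structure IsRieszKernel (A : ℝ) (κ : ℝ → ℝ) : Prop where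
  continuous : Continuous κ
  -- `R` serves only to make integrals converge; no estimate depends on it.
  eq_zero : ∃ R, ∀ r, R ≤ r → κ r = 0
  abs_le : ∀ r, 0 < r → |κ r| ≤ (√r)⁻¹
  -- The integrated form of `|κ'(r)| ≤ A r^{-3/2}`.
  abs_sub_le : ∀ s r, 0 < s → s ≤ r → |κ r - κ s| ≤ A * (r - s) / (s * √s)

namespace IsRieszKernel

variable {A : ℝ} {κ : ℝ → ℝ}

theorem nonneg (h : IsRieszKernel A κ) : 0 ≤ A := by
  have := (abs_nonneg _).trans (h.abs_sub_le 1 2 one_pos one_le_two)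
  norm_num at this
  exact this

theorem abs_sub_le' (h : IsRieszKernel A κ) {m r s : ℝ} (hm : 0 < m) (hr : m ≤ r) (hs : m ≤ s) :
    |κ r - κ s| ≤ A * |r - s| / (m * √m) := by
  wlog hsr : s ≤ r generalizing r s
  · rw [abs_sub_comm, abs_sub_comm r]
    exact this hs hr (le_of_not_ge hsr)
  have hA := h.nonneg
  refine (h.abs_sub_le s r (hm.trans_le hs) hsr).trans ?_
  rw [abs_of_nonneg (sub_nonneg.2 hsr)]
  have : 0 ≤ A * (r - s) := mul_nonneg hA (sub_nonneg.2 hsr)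
  have : 0 < √m := Real.sqrt_pos.2 hm
  have := hm.le.trans hs
  gcongr

theorem hasCompactSupport_comp_abs (h : IsRieszKernel A κ) :
    HasCompactSupport fun x : ℝ => κ |x| := by
  obtain ⟨R, hR⟩ := h.eq_zero
  refine HasCompactSupport.intro (isCompact_Icc (a := -R) (b := R)) fun x hx => hR _ ?_
  by_contra hlt
  exact hx (_root_.abs_le.1 (not_le.1 hlt).le)

theorem exists_bound (h : IsRieszKernel A κ) : ∃ B, ∀ r, 0 ≤ r → |κ r| ≤ B := by
  obtain ⟨B, hB⟩ := h.hasCompactSupport_comp_abs.exists_bound_of_continuous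
    (h.continuous.comp continuous_abs)
  exact ⟨B, fun r hr => by simpa [abs_of_nonneg hr] using hB r⟩

/-- The `L¹` modulus of continuity is of order `1/2`. For `|x| ≤ 2|s|` both terms are bounded by the
integrable singularity `t^{-1/2}` on `|t| ≤ 3|s|`, which contributes `8√3 √|s|`. For `|x| > 2|s|`
both arguments are at least `|x|/2` in modulus, and the difference bound integrates to `8A √|s|`. -/
theorem lintegral_translate_le (h : IsRieszKernel A κ) {s : ℝ} (hs : s ≠ 0) :
    ∫⁻ x : ℝ, ‖κ |x| - κ |x + s|‖ₑ ≤ ENNReal.ofReal ((8 * √3 + 8 * A) * √|s|) := by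
  have hA := h.nonneg
  have hs' : 0 < |s| := abs_pos.2 hs
  set I : ℝ → ℝ≥0∞ := fun x => (Iic (3 * |s|)).indicator (fun t => ENNReal.ofReal (√t)⁻¹) |x|
  set J : ℝ → ℝ≥0∞ := fun x =>
    (Ioi (2 * |s|)).indicator (fun t => ENNReal.ofReal (t ^ (-(3 / 2) : ℝ))) |x|
  have hIm : Measurable I := by
    refine (Measurable.indicator ?_ measurableSet_Iic).comp measurable_norm
    fun_prop
  have key : ∀ᵐ x : ℝ, ‖κ |x| - κ |x + s|‖ₑ ≤
      I x + I (x + s) + ENNReal.ofReal (A * |s| * (2 * √2)) * J x := by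
    have h0 : ∀ᵐ x : ℝ, x ≠ 0 := by simp [ae_iff]
    have h1 : ∀ᵐ x : ℝ, x ≠ -s := by simp [ae_iff]
    filter_upwards [h0, h1] with x hx0 hx1
    have hx0' : 0 < |x| := abs_pos.2 hx0
    have hx1' : 0 < |x + s| := abs_pos.2 fun h => hx1 (by linarith)
    rw [Real.enorm_eq_ofReal_abs]
    rcases le_or_gt |x| (2 * |s|) with hx | hx
    · have hxs : |x + s| ≤ 3 * |s| := (abs_add_le x s).trans (by linarith)
      have e1 : I x = ENNReal.ofReal (√|x|)⁻¹ :=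
        indicator_of_mem (mem_Iic.2 (by linarith)) _
      have e2 : I (x + s) = ENNReal.ofReal (√|x + s|)⁻¹ := indicator_of_mem (mem_Iic.2 hxs) _
      rw [e1, e2, ← ENNReal.ofReal_add (by positivity) (by positivity)]
      refine le_add_right (ENNReal.ofReal_le_ofReal ?_)
      exact (abs_sub _ _).trans (add_le_add (h.abs_le _ hx0') (h.abs_le _ hx1'))
    · have e3 : J x = ENNReal.ofReal (|x| ^ (-(3 / 2) : ℝ)) := indicator_of_mem (mem_Ioi.2 hx) _
      rw [e3, ← ENNReal.ofReal_mul (by positivity)]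
      refine le_add_left (ENNReal.ofReal_le_ofReal ?_)
      have hlow : |x| / 2 ≤ |x + s| := by
        have := abs_sub_abs_le_abs_sub x (-s)
        rw [abs_neg, sub_neg_eq_add] at this
        linarith
      refine (h.abs_sub_le' (m := |x| / 2) (by positivity) (by linarith) hlow).trans ?_
      have hd : |(|x| - |x + s|)| ≤ |s| := by
        have := abs_abs_sub_abs_le x (x + s)
        rwa [sub_add_cancel_left, abs_neg] at this
      have e4 : |x| ^ (-(3 / 2) : ℝ) = (|x| * √|x|)⁻¹ := by
        rw [Real.rpow_neg hx0'.le, show (3 / 2 : ℝ) = 1 + 1 / 2 by norm_num, Real.rpow_add hx0',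
          Real.rpow_one, Real.sqrt_eq_rpow]
      have e5 : |x| / 2 * √(|x| / 2) = (|x| * √|x|) / (2 * √2) := by
        rw [Real.sqrt_div hx0'.le]; ring
      rw [e4, e5, div_div_eq_mul_div, div_eq_mul_inv]
      gcongr
  refine (lintegral_mono_ae key).trans ?_
  have hJ2 : ∫⁻ x, J x = ENNReal.ofReal (2 * (-(2 * |s|) ^ (-(3 / 2) + 1 : ℝ) / (-(3 / 2) + 1))) :=
    lintegral_rpow_abs_gt (by positivity) (by norm_num)
  rw [lintegral_add_left (by fun_prop), lintegral_add_left hIm,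
    lintegral_const_mul' _ _ ENNReal.ofReal_ne_top, hJ2, lintegral_add_right_eq_self,
    lintegral_inv_sqrt_abs (by positivity), ← ENNReal.ofReal_mul (by positivity),
    ← ENNReal.ofReal_add (by positivity) (by positivity), ← ENNReal.ofReal_add (by positivity)]
  · refine ENNReal.ofReal_le_ofReal (le_of_eq ?_)
    have e6 : (2 * |s|) ^ (-(3 / 2) + 1 : ℝ) = (√2 * √|s|)⁻¹ := by
      rw [← Real.sqrt_mul (by norm_num), Real.sqrt_eq_rpow, ← Real.rpow_neg (by positivity)]
      norm_num
    rw [e6, Real.sqrt_mul (by norm_num)]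
    have h2 : √2 ≠ 0 := by positivity
    have h3 : √|s| ≠ 0 := by positivity
    have h4 : √|s| * √|s| = |s| := Real.mul_self_sqrt hs'.le
    rw [show A * |s| = A * (√|s| * √|s|) by rw [h4]]
    field_simp
    ring
  · have : (0 : ℝ) ≤ (2 * |s|) ^ (-(3 / 2) + 1 : ℝ) := by positivity
    refine mul_nonneg (by positivity) (mul_nonneg (by norm_num) ?_)
    rw [neg_div, ← div_neg]
    exact div_nonneg this (by norm_num)

-- Translating by half a period, `s = 1/(2ξ)`, flips the sign of the character, so the transform at
-- `ξ` is half that of `K - K(· + s)`. The `L¹` bound on this difference gives decay `|ξ|^{-1/2}`,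
-- uniformly over the class.
open scoped FourierTransform in
theorem norm_fourier_sq_le (h : IsRieszKernel A κ) (ξ : ℝ) :
    ‖𝓕 (fun x : ℝ => (κ |x| : ℂ)) ξ‖ₑ ^ 2 * ‖ξ‖ₑ ≤
      ENNReal.ofReal ((8 * √3 + 8 * A) ^ 2 / 8) := by
  have hA := h.nonneg
  rcases eq_or_ne ξ 0 with rfl | hξ
  · simp
  have hint : Integrable fun x : ℝ => (κ |x| : ℂ) :=
    ((h.continuous.comp continuous_abs).integrable_of_hasCompactSupport
      h.hasCompactSupport_comp_abs).ofReal
  set s : ℝ := 1 / (2 * ‖ξ‖ ^ 2) * ξ with hs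
  have hξ' : 0 < |ξ| := abs_pos.2 hξ
  have hs0 : s ≠ 0 := by positivity
  have hsabs : |s| = 1 / (2 * |ξ|) := by
    rw [hs, abs_mul, Real.norm_eq_abs, abs_of_nonneg (by positivity : 0 ≤ 1 / (2 * |ξ| ^ 2))]
    field_simp
  have h1 : 𝓕 (fun x : ℝ => (κ |x| : ℂ)) ξ = _ :=
    fourierIntegral_eq_half_sub_half_period_translate hξ hint
  have h2 : ‖𝓕 (fun x : ℝ => (κ |x| : ℂ)) ξ‖ₑ ≤
      ENNReal.ofReal (1 / 2) * ENNReal.ofReal ((8 * √3 + 8 * A) * √|s|) := by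
    rw [h1, enorm_smul]
    gcongr
    · rw [← ofReal_norm]; norm_num
    · refine (enorm_integral_le_lintegral_enorm _).trans ((le_of_eq ?_).trans
        (h.lintegral_translate_le hs0))
      refine lintegral_congr fun x => ?_
      rw [Circle.smul_def, enorm_smul, ← ofReal_norm, Circle.norm_coe, ENNReal.ofReal_one,
        one_mul, ← Complex.ofReal_sub, ← ofReal_norm, Complex.norm_real,
        ofReal_norm]
      rfl
  calc _ ≤ (ENNReal.ofReal (1 / 2) * ENNReal.ofReal ((8 * √3 + 8 * A) * √|s|)) ^ 2 * ‖ξ‖ₑ := by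
        gcongr
    _ = _ := by
        rw [← ENNReal.ofReal_mul (by norm_num), Real.enorm_eq_ofReal_abs,
          ← ENNReal.ofReal_pow (by positivity), ← ENNReal.ofReal_mul (by positivity), hsabs,
          mul_pow, mul_pow, Real.sq_sqrt (by positivity)]
        congr 1
        field_simp
        norm_num

end IsRieszKernel

/-! ### The Riesz potential on a line -/

/-- Split at `|h| = 1/|ξ|`: below, `|exp(iθ) - 1| ≤ |θ|` contributes `8π²|ξ|`; above, the bound `2`
contributes `8|ξ|`. -/
theorem lintegral_fourierChar_sub_one_sq_le (ξ : ℝ) :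
    ∫⁻ h : ℝ, ‖(Real.fourierChar (h * ξ) : ℂ) - 1‖ₑ ^ 2 / ‖h‖ₑ ^ 2 ≤
      ENNReal.ofReal (8 * Real.pi ^ 2 + 8) * ‖ξ‖ₑ := by
  rcases eq_or_ne ξ 0 with rfl | hξ
  · simp
  have hξ' : 0 < |ξ| := abs_pos.2 hξ
  set a : ℝ := |ξ|⁻¹ with ha
  have ha0 : 0 < a := inv_pos.2 hξ'
  have key : ∀ᵐ h : ℝ, ‖(Real.fourierChar (h * ξ) : ℂ) - 1‖ₑ ^ 2 / ‖h‖ₑ ^ 2 ≤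
      (Icc (-a) a).indicator (fun _ => ENNReal.ofReal ((2 * Real.pi * |ξ|) ^ 2)) h +
      ENNReal.ofReal 4 * (Ioi a).indicator (fun t => ENNReal.ofReal (t ^ (-2 : ℝ))) |h| := by
    have h0 : ∀ᵐ x : ℝ, x ≠ 0 := by simp [ae_iff]
    filter_upwards [h0] with h hh
    have hh' : 0 < |h| := abs_pos.2 hh
    have e1 : ‖(Real.fourierChar (h * ξ) : ℂ) - 1‖ₑ ^ 2 / ‖h‖ₑ ^ 2 =
        ENNReal.ofReal (‖(Real.fourierChar (h * ξ) : ℂ) - 1‖ ^ 2 / |h| ^ 2) := by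
      rw [ENNReal.ofReal_div_of_pos (by positivity), ENNReal.ofReal_pow (norm_nonneg _),
        ENNReal.ofReal_pow (abs_nonneg _), ofReal_norm, Real.enorm_eq_ofReal_abs]
    rw [e1]
    rcases le_or_gt |h| a with hle | hlt
    · rw [indicator_of_mem (mem_Icc.2 (_root_.abs_le.1 hle))]
      refine le_add_right (ENNReal.ofReal_le_ofReal ?_)
      have e2 : ‖(Real.fourierChar (h * ξ) : ℂ) - 1‖ ≤ 2 * Real.pi * (|h| * |ξ|) := by
        have := Real.norm_exp_I_mul_ofReal_sub_one_le (x := 2 * Real.pi * (h * ξ))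
        rw [Real.fourierChar_apply, mul_comm _ Complex.I]
        simpa [abs_mul, abs_of_pos Real.pi_pos] using this
      rw [div_le_iff₀ (by positivity), ← mul_pow]
      gcongr
      linarith
    · rw [indicator_of_mem (mem_Ioi.2 hlt), ← ENNReal.ofReal_mul (by norm_num)]
      refine le_add_left (ENNReal.ofReal_le_ofReal ?_)
      have e2 : ‖(Real.fourierChar (h * ξ) : ℂ) - 1‖ ≤ 2 := by
        refine (norm_sub_le _ _).trans ?_
        rw [Circle.norm_coe, norm_one]; norm_num
      rw [Real.rpow_neg hh'.le, Real.rpow_two, div_eq_mul_inv]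
      gcongr
      calc _ ≤ (2 : ℝ) ^ 2 := by gcongr
        _ = 4 := by norm_num
  refine (lintegral_mono_ae key).trans ?_
  have e3 := lintegral_rpow_abs_gt ha0 (by norm_num : (-2 : ℝ) < -1)
  rw [lintegral_add_left (measurable_const.indicator measurableSet_Icc),
    lintegral_const_mul' _ _ ENNReal.ofReal_ne_top, e3,
    lintegral_indicator_const measurableSet_Icc, Real.volume_Icc,
    ← ENNReal.ofReal_mul (by positivity), ← ENNReal.ofReal_mul (by positivity),
    ← ENNReal.ofReal_add (mul_nonneg (by positivity) (by linarith)), Real.enorm_eq_ofReal_abs,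
    ← ENNReal.ofReal_mul (by positivity)]
  · refine ENNReal.ofReal_le_ofReal (le_of_eq ?_)
    rw [show (-2 + 1 : ℝ) = -1 by norm_num, Real.rpow_neg_one, ha]
    field_simp
    ring
  · rw [show (-2 + 1 : ℝ) = -1 by norm_num, Real.rpow_neg_one]
    have : 0 < a⁻¹ := by positivity
    norm_num
    exact ha0.le

open scoped FourierTransform in
/-- The Gagliardo seminorm of order `1/2` is controlled by the Fourier transform. -/
theorem lintegral_lintegral_sub_sq_div_le {W : ℝ → ℂ} (hc : Continuous W) (hW : Integrable W)
    (hW2 : MemLp W 2) :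
    ∫⁻ x, ∫⁻ y, ‖W x - W y‖ₑ ^ 2 / edist x y ^ 2 ≤
      ENNReal.ofReal (8 * Real.pi ^ 2 + 8) * ∫⁻ ξ, ‖𝓕 W ξ‖ₑ ^ 2 * ‖ξ‖ₑ := by
  have hFc : Continuous (𝓕 W) := VectorFourier.fourierIntegral_continuous
    Real.continuous_fourierChar (by exact continuous_inner) hW
  -- For a fixed shift `h`, Plancherel in `x` turns the increment into multiplication by a character
  -- minus one.
  have step : ∀ h : ℝ, ∫⁻ x, ‖W x - W (x + h)‖ₑ ^ 2 / edist x (x + h) ^ 2 =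
      ∫⁻ ξ, ‖(Real.fourierChar (h * ξ) : ℂ) - 1‖ₑ ^ 2 / ‖h‖ₑ ^ 2 * ‖𝓕 W ξ‖ₑ ^ 2 := by
    intro h
    have hi' : Integrable (W ∘ fun x => x + h) := hW.comp_add_right h
    have h2' : MemLp (W ∘ fun x => x + h) 2 :=
      hW2.comp_measurePreserving (measurePreserving_add_right _ h)
    have hF : 𝓕 (W ∘ (fun x => x + h) - W) =
        fun ξ => ((Real.fourierChar (h * ξ) : ℂ) - 1) * 𝓕 W ξ := by
      have a1 : 𝓕 (W ∘ fun x => x + h) = fun ξ => Real.fourierChar (innerₗ ℝ h ξ) • 𝓕 W ξ :=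
        VectorFourier.fourierIntegral_comp_add_right Real.fourierChar volume (innerₗ ℝ) W h
      have a2 : 𝓕 (W ∘ (fun x => x + h) - W) = 𝓕 (W ∘ fun x => x + h) - 𝓕 W := by
        ext ξ
        simp only [Real.fourier_eq, Pi.sub_apply, smul_sub]
        exact integral_sub ((Real.fourierIntegral_convergent_iff ξ).2 hi')
          ((Real.fourierIntegral_convergent_iff ξ).2 hW)
      rw [a2, a1]
      ext ξ
      simp [Circle.smul_def, sub_mul, mul_comm h ξ]
    have hP := lintegral_enorm_fourier_sq (hi'.sub hW) (h2'.sub hW2)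
    have e1 : ∀ x, ‖W x - W (x + h)‖ₑ ^ 2 / edist x (x + h) ^ 2 =
        ‖(W ∘ (fun x => x + h) - W) x‖ₑ ^ 2 * (‖h‖ₑ ^ 2)⁻¹ := fun x => by
      rw [edist_comm x, edist_eq_enorm_sub, add_sub_cancel_left, enorm_sub_rev]; rfl
    have hm : Measurable fun x => ‖(W ∘ (fun x => x + h) - W) x‖ₑ ^ 2 := by
      have : Continuous (W ∘ (fun x => x + h) - W) := by fun_prop
      fun_prop
    simp_rw [e1]
    rw [lintegral_mul_const _ hm, ← hP, hF, ← lintegral_mul_const _ (by fun_prop)]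
    refine lintegral_congr fun ξ => ?_
    simp only [enorm_mul, mul_pow, div_eq_mul_inv]
    ring
  calc ∫⁻ x, ∫⁻ y, ‖W x - W y‖ₑ ^ 2 / edist x y ^ 2
      = ∫⁻ x, ∫⁻ h, ‖W x - W (x + h)‖ₑ ^ 2 / edist x (x + h) ^ 2 :=
        lintegral_congr fun x => (lintegral_add_left_eq_self
          (fun y => ‖W x - W y‖ₑ ^ 2 / edist x y ^ 2) x).symm
    _ = ∫⁻ h, ∫⁻ x, ‖W x - W (x + h)‖ₑ ^ 2 / edist x (x + h) ^ 2 :=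
        lintegral_lintegral_swap (by dsimp only [Function.uncurry_def]; fun_prop)
    _ = ∫⁻ h, ∫⁻ ξ, ‖(Real.fourierChar (h * ξ) : ℂ) - 1‖ₑ ^ 2 / ‖h‖ₑ ^ 2 * ‖𝓕 W ξ‖ₑ ^ 2 :=
        lintegral_congr step
    _ = ∫⁻ ξ, ∫⁻ h, ‖(Real.fourierChar (h * ξ) : ℂ) - 1‖ₑ ^ 2 / ‖h‖ₑ ^ 2 * ‖𝓕 W ξ‖ₑ ^ 2 :=
        lintegral_lintegral_swap (by
          dsimp only [Function.uncurry_def]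
          have := Real.continuous_fourierChar
          fun_prop)
    _ ≤ ∫⁻ ξ, ENNReal.ofReal (8 * Real.pi ^ 2 + 8) * (‖𝓕 W ξ‖ₑ ^ 2 * ‖ξ‖ₑ) := by
        refine lintegral_mono fun ξ => ?_
        rw [lintegral_mul_const _ (by
          have := Real.continuous_fourierChar
          fun_prop)]
        calc _ ≤ ENNReal.ofReal (8 * Real.pi ^ 2 + 8) * ‖ξ‖ₑ * ‖𝓕 W ξ‖ₑ ^ 2 := by
              gcongr; exact lintegral_fourierChar_sub_one_sq_le ξ
          _ = _ := by ring
    _ = _ := lintegral_const_mul _ (by fun_prop)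

-- The potential is the convolution `U ⋆ K`, so its transform is a product, and `|𝓕 K|² |ξ|` is
-- bounded. The weight `|ξ|` is thus absorbed and Plancherel returns the `L²` norm of `U`.
open scoped FourierTransform Convolution in
theorem IsRieszKernel.lintegral_lintegral_complex_le {A : ℝ} {κ : ℝ → ℝ} (h : IsRieszKernel A κ)
    {U : ℝ → ℂ} (hU : Integrable U) (hU2 : MemLp U 2) :
    ∫⁻ x, ∫⁻ y, ‖(∫ t, κ |x - t| • U t) - ∫ t, κ |y - t| • U t‖ₑ ^ 2 / edist x y ^ 2 ≤
      ENNReal.ofReal (8 * Real.pi ^ 2 + 8) * ENNReal.ofReal ((8 * √3 + 8 * A) ^ 2 / 8) *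
        ∫⁻ t, ‖U t‖ₑ ^ 2 := by
  set K : ℝ → ℂ := fun x => (κ |x| : ℂ) with hK
  have hKc : Continuous K := Complex.continuous_ofReal.comp (h.continuous.comp continuous_abs)
  have hKs : HasCompactSupport K :=
    h.hasCompactSupport_comp_abs.comp_left (g := fun t : ℝ => (t : ℂ)) (by simp)
  have hKi : Integrable K := hKc.integrable_of_hasCompactSupport hKs
  set W : ℝ → ℂ := U ⋆[ContinuousLinearMap.mul ℂ ℂ] K with hWdef
  have hWx : ∀ x, W x = ∫ t, κ |x - t| • U t := fun x => by
    simp [hWdef, hK, convolution_def, mul_comm]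
  have hWi : Integrable W := hU.integrable_convolution _ hKi
  have hWc : Continuous W := hKs.continuous_convolution_right _ hU.locallyIntegrable hKc
  have hW2 : MemLp W 2 := by
    obtain ⟨B, hB⟩ := h.exists_bound
    have hB' : ∀ x, ‖W x‖ ≤ B * ∫ t, ‖U t‖ := fun x => by
      rw [hWx, ← integral_const_mul]
      refine norm_integral_le_of_norm_le (hU.norm.const_mul B) (.of_forall fun t => ?_)
      rw [norm_smul, Real.norm_eq_abs]
      gcongr
      exact hB _ (abs_nonneg _)
    rw [memLp_two_iff_integrable_sq_norm hWc.aestronglyMeasurable]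
    simp_rw [sq]
    exact hWi.norm.bdd_mul hWc.norm.aestronglyMeasurable
      (.of_forall fun x => by rw [norm_norm]; exact hB' x)
  simp_rw [← hWx]
  refine (lintegral_lintegral_sub_sq_div_le hWc hWi hW2).trans ?_
  rw [mul_assoc]
  gcongr
  rw [← lintegral_enorm_fourier_sq hU hU2, ← lintegral_const_mul' _ _ ENNReal.ofReal_ne_top]
  refine lintegral_mono fun ξ => ?_
  rw [hWdef, Real.fourier_mul_convolution_eq hU hKi, enorm_mul, mul_pow]
  calc _ = (‖𝓕 K ξ‖ₑ ^ 2 * ‖ξ‖ₑ) * ‖𝓕 U ξ‖ₑ ^ 2 := by ring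
    _ ≤ _ := by gcongr; exact h.norm_fourier_sq_le ξ

/-- **The Riesz potential of order `1/2` maps `L²(ℝ)` to `H^{1/2}(ℝ)`**, uniformly over regularized
kernels. -/
theorem IsRieszKernel.lintegral_lintegral_le {𝕜 : Type*} [RCLike 𝕜] {A : ℝ} {κ : ℝ → ℝ}
    (h : IsRieszKernel A κ) {U : ℝ → 𝕜} (hU : Integrable U) (hU2 : MemLp U 2) :
    ∫⁻ x, ∫⁻ y, ‖(∫ t, κ |x - t| • U t) - ∫ t, κ |y - t| • U t‖ₑ ^ 2 / edist x y ^ 2 ≤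
      ENNReal.ofReal (8 * Real.pi ^ 2 + 8) * ENNReal.ofReal ((8 * √3 + 8 * A) ^ 2 / 8) *
        ∫⁻ t, ‖U t‖ₑ ^ 2 := by
  -- The canonical map to `ℂ` is linear and norm preserving, so the complex case suffices.
  set L := RCLike.map 𝕜 ℂ
  have hL : ∀ z, ‖L z‖ = ‖z‖ := fun z => by
    rw [← sq_eq_sq₀ (norm_nonneg _) (norm_nonneg _), ← RCLike.normSq_eq_def', ← RCLike.normSq_eq_def']
    simp [L, RCLike.map_apply, RCLike.normSq_apply]
  have hL' : ∀ z, ‖L z‖ₑ = ‖z‖ₑ := fun z => by rw [← ofReal_norm, hL, ofReal_norm]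
  have hi : ∀ x : ℝ, Integrable fun t => κ |x - t| • U t := fun x => by
    obtain ⟨B, hB⟩ := h.exists_bound
    have hc := h.continuous
    exact hU.bdd_smul B (by fun_prop : Continuous fun t => κ |x - t|).aestronglyMeasurable
      (.of_forall fun t => hB _ (abs_nonneg _))
  have := h.lintegral_lintegral_complex_le (L.integrable_comp hU)
    (hU2.of_le_mul (c := 1) (L.continuous.comp_aestronglyMeasurable hU.aestronglyMeasurable)
      (.of_forall fun t => by rw [one_mul, hL]))
  simp only [hL'] at this
  refine le_trans (le_of_eq ?_) this
  refine lintegral_congr fun x => lintegral_congr fun y => ?_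
  simp_rw [← L.map_smul]
  rw [L.integral_comp_comm (hi x), L.integral_comp_comm (hi y), ← map_sub, hL']

/-! ### The Gagliardo seminorm -/

section Gagliardo

variable {X : Type*} [MetricSpace X] [MeasurableSpace X] {𝕜 : Type*} [RCLike 𝕜]

/-- The square of the Gagliardo seminorm of order `1/2` for a measure `μ`. -/
noncomputable def gagliardo (μ : Measure X) (w : X → 𝕜) : ℝ≥0∞ :=
  ∫⁻ p, ‖w p.1 - w p.2‖ₑ ^ 2 / edist p.1 p.2 ^ 2 ∂(μ.prod μ)

theorem ennreal_add_sq_le (a b : ℝ≥0∞) : (a + b) ^ 2 ≤ 4 * a ^ 2 + 4 * b ^ 2 := by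
  wlog h : a ≤ b generalizing a b
  · rw [add_comm a, add_comm (4 * _)]
    exact this b a (le_of_not_ge h)
  calc (a + b) ^ 2 ≤ (b + b) ^ 2 := by gcongr
    _ = 4 * b ^ 2 := by ring
    _ ≤ _ := le_add_self

theorem gagliardo_mono {μ ν : Measure X} [SFinite μ] [SFinite ν] (h : μ ≤ ν) (w : X → 𝕜) :
    gagliardo μ w ≤ gagliardo ν w :=
  lintegral_mono' (Measure.prod_mono h h) le_rfl

theorem gagliardo_restrict (μ : Measure X) [SFinite μ] (V : Set X) (w : X → 𝕜) :
    gagliardo (μ.restrict V) w =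
      ∫⁻ p in V ×ˢ V, ‖w p.1 - w p.2‖ₑ ^ 2 / edist p.1 p.2 ^ 2 ∂(μ.prod μ) := by
  rw [gagliardo, Measure.prod_restrict]

theorem gagliardo_restrict_le_of_lipschitz (μ : Measure X) [SFinite μ] {V : Set X}
    {g : X → 𝕜} {c : ℝ≥0∞}
    (hg : ∀ x ∈ V, ∀ y ∈ V, ‖g x - g y‖ₑ ≤ c * edist x y) :
    gagliardo (μ.restrict V) g ≤ c ^ 2 * (μ univ * μ univ) := by
  rw [gagliardo_restrict]
  calc _ ≤ ∫⁻ p in V ×ˢ V, c ^ 2 ∂(μ.prod μ) := by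
        refine setLIntegral_mono measurable_const fun p hp => ?_
        refine ENNReal.div_le_of_le_mul ?_
        rw [← mul_pow]
        exact pow_le_pow_left' (hg _ hp.1 _ hp.2) 2
    _ ≤ _ := by
        rw [setLIntegral_const, ← Measure.prod_prod, univ_prod_univ]
        gcongr
        exact subset_univ _

variable [BorelSpace X] [SecondCountableTopology X]

theorem gagliardo_add_le (μ : Measure X) {g₁ g₂ : X → 𝕜} (h₁ : Continuous g₁) :
    gagliardo μ (g₁ + g₂) ≤ 4 * gagliardo μ g₁ + 4 * gagliardo μ g₂ := by
  rw [gagliardo, gagliardo, gagliardo, ← lintegral_const_mul _ (by fun_prop),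
    ← lintegral_const_mul' _ _ (by simp), ← lintegral_add_left (by fun_prop)]
  refine lintegral_mono fun p => ?_
  calc ‖(g₁ + g₂) p.1 - (g₁ + g₂) p.2‖ₑ ^ 2 / edist p.1 p.2 ^ 2
      ≤ (‖g₁ p.1 - g₁ p.2‖ₑ + ‖g₂ p.1 - g₂ p.2‖ₑ) ^ 2 / edist p.1 p.2 ^ 2 := by
        gcongr
        simp only [Pi.add_apply, add_sub_add_comm]
        exact enorm_add_le _ _
    _ ≤ (4 * ‖g₁ p.1 - g₁ p.2‖ₑ ^ 2 + 4 * ‖g₂ p.1 - g₂ p.2‖ₑ ^ 2) / edist p.1 p.2 ^ 2 := by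
        gcongr; exact ennreal_add_sq_le _ _
    _ = _ := by rw [ENNReal.add_div, mul_div_assoc, mul_div_assoc]

/-- Leibniz splitting of the increment of `χ • g`: in the term with `χ p.1 - χ p.2` the Lipschitz
bound cancels the denominator and leaves an `L²` norm. -/
theorem gagliardo_smul_le (μ : Measure X) [SFinite μ] {χ : X → ℝ} {B L : ℝ≥0}
    (hB : ∀ x, ‖χ x‖ₑ ≤ B) (hL : LipschitzWith L χ) {g : X → 𝕜} (hg : Continuous g) :
    gagliardo μ (fun x => χ x • g x) ≤
      4 * B ^ 2 * gagliardo μ g + 4 * L ^ 2 * μ univ * ∫⁻ x, ‖g x‖ₑ ^ 2 ∂μ := by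
  have hm : Measurable fun x => ‖g x‖ₑ ^ 2 := hg.enorm.measurable.pow_const 2
  have hm2 : Measurable fun p : X × X => ‖g p.2‖ₑ ^ 2 := hm.comp measurable_snd
  have e : 4 * (L : ℝ≥0∞) ^ 2 * μ univ * ∫⁻ x, ‖g x‖ₑ ^ 2 ∂μ =
      ∫⁻ p, 4 * L ^ 2 * ‖g p.2‖ₑ ^ 2 ∂(μ.prod μ) := by
    rw [lintegral_const_mul _ (by fun_prop), lintegral_prod _ (by fun_prop)]
    simp only [lintegral_const]
    ring
  rw [e, gagliardo, gagliardo, ← lintegral_const_mul _ (by fun_prop),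
    ← lintegral_add_left (by fun_prop)]
  refine lintegral_mono fun p => ?_
  have h1 : ‖χ p.1 • g p.1 - χ p.2 • g p.2‖ₑ ≤
      B * ‖g p.1 - g p.2‖ₑ + L * edist p.1 p.2 * ‖g p.2‖ₑ := by
    have : χ p.1 • g p.1 - χ p.2 • g p.2 =
        χ p.1 • (g p.1 - g p.2) + (χ p.1 - χ p.2) • g p.2 := by
      rw [smul_sub, sub_smul]; abel
    rw [this]
    refine (enorm_add_le _ _).trans ?_
    rw [enorm_smul, enorm_smul, ← edist_eq_enorm_sub (χ p.1)]
    gcongr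
    · exact hB _
    · exact hL _ _
  calc ‖χ p.1 • g p.1 - χ p.2 • g p.2‖ₑ ^ 2 / edist p.1 p.2 ^ 2
      ≤ (4 * (B * ‖g p.1 - g p.2‖ₑ) ^ 2 + 4 * (L * edist p.1 p.2 * ‖g p.2‖ₑ) ^ 2) /
          edist p.1 p.2 ^ 2 := by
        gcongr
        exact (pow_le_pow_left' h1 2).trans (ennreal_add_sq_le _ _)
    _ = 4 * B ^ 2 * (‖g p.1 - g p.2‖ₑ ^ 2 / edist p.1 p.2 ^ 2) +
          4 * L ^ 2 * ‖g p.2‖ₑ ^ 2 * (edist p.1 p.2 ^ 2 / edist p.1 p.2 ^ 2) := by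
        rw [ENNReal.add_div]
        simp only [div_eq_mul_inv]
        ring
    _ ≤ _ := by
        exact add_le_add le_rfl
          ((mul_le_mul_right ENNReal.div_self_le_one _).trans_eq (mul_one _))

/-- Bounds for the Gagliardo seminorm on a compact set are local. -/
theorem exists_gagliardo_le_of_local {ι : Type*} (μ : Measure X) [IsFiniteMeasure μ] {Γ : Set X}
    (hΓ : IsCompact Γ) (hμ : μ Γᶜ = 0) {w : ι → X → 𝕜} {E : ι → ℝ≥0∞}
    (hw : ∀ i, Continuous (w i)) {M : ℝ≥0} (hM : ∀ i, ∫⁻ x, ‖w i x‖ₑ ^ 2 ∂μ ≤ M * E i)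
    (hloc : ∀ p ∈ Γ, ∃ r > 0, ∃ C : ℝ≥0, ∀ i,
      gagliardo (μ.restrict (Metric.ball p r)) (w i) ≤ C * E i) :
    ∃ C : ℝ≥0, ∀ i, gagliardo μ (w i) ≤ C * E i := by
  choose! r hr C hC using hloc
  obtain ⟨t, ht⟩ := hΓ.elim_nhds_subcover' (fun p _ => Metric.ball p (r p))
    fun p hp => Metric.ball_mem_nhds p (hr p hp)
  obtain ⟨δ, hδ, hδt⟩ := lebesgue_number_lemma_of_metric (s := Γ)
    (c := fun p : t => Metric.ball (p : X) (r p)) hΓ (fun _ => Metric.isOpen_ball)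
    (by simpa [iUnion_subtype] using ht)
  have hδ' : (ENNReal.ofReal δ) ^ 2 ≠ 0 := by simpa using hδ
  refine ⟨8 * (μ univ).toNNReal * M / δ.toNNReal ^ 2 + ∑ p : t, C p, fun i => ?_⟩
  -- `δ` is a Lebesgue number of the cover: two points of `Γ` closer than `δ` share one of the
  -- balls.
  have hae : ∀ᵐ p ∂(μ.prod μ), p ∈ {p : X × X | δ ≤ dist p.1 p.2} ∪
      ⋃ q : t, Metric.ball (q : X) (r q) ×ˢ Metric.ball (q : X) (r q) := by
    have h1 : ∀ᵐ p ∂(μ.prod μ), p.1 ∈ Γ :=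
      Measure.quasiMeasurePreserving_fst.ae (by rwa [ae_iff])
    have h2 : ∀ᵐ p ∂(μ.prod μ), p.2 ∈ Γ :=
      Measure.quasiMeasurePreserving_snd.ae (by rwa [ae_iff])
    filter_upwards [h1, h2] with p hp1 hp2
    by_cases hd : δ ≤ dist p.1 p.2
    · exact Or.inl hd
    · obtain ⟨q, hq⟩ := hδt p.1 hp1
      refine Or.inr (mem_iUnion.2 ⟨q, hq (Metric.mem_ball_self hδ), hq ?_⟩)
      rw [Metric.mem_ball, dist_comm]
      exact not_le.1 hd
  have hfar : ∫⁻ p in {p : X × X | δ ≤ dist p.1 p.2},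
      ‖w i p.1 - w i p.2‖ₑ ^ 2 / edist p.1 p.2 ^ 2 ∂(μ.prod μ) ≤
      (8 * (μ univ).toNNReal * M / δ.toNNReal ^ 2 : ℝ≥0) * E i := by
    have hm : Measurable fun x => ‖w i x‖ₑ ^ 2 := (hw i).enorm.measurable.pow_const 2
    have hm1 : Measurable fun p : X × X => ‖w i p.1‖ₑ ^ 2 := hm.comp measurable_fst
    have hm2 : Measurable fun p : X × X => ‖w i p.2‖ₑ ^ 2 := hm.comp measurable_snd
    calc _ ≤ ∫⁻ p in {p : X × X | δ ≤ dist p.1 p.2},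
          (4 * ‖w i p.1‖ₑ ^ 2 + 4 * ‖w i p.2‖ₑ ^ 2) / ENNReal.ofReal δ ^ 2 ∂(μ.prod μ) := by
          refine setLIntegral_mono (by fun_prop) fun p hp => ?_
          gcongr
          · exact (pow_le_pow_left' enorm_sub_le 2).trans (ennreal_add_sq_le _ _)
          · rw [edist_dist]; exact ENNReal.ofReal_le_ofReal hp
      _ ≤ ∫⁻ p, (4 * ‖w i p.1‖ₑ ^ 2 + 4 * ‖w i p.2‖ₑ ^ 2) / ENNReal.ofReal δ ^ 2 ∂(μ.prod μ) :=
          setLIntegral_le_lintegral _ _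
      _ = 8 * μ univ * (∫⁻ x, ‖w i x‖ₑ ^ 2 ∂μ) / ENNReal.ofReal δ ^ 2 := by
          simp only [div_eq_mul_inv]
          rw [lintegral_mul_const _ (by fun_prop), lintegral_add_left (by fun_prop),
            lintegral_const_mul _ (by fun_prop), lintegral_const_mul _ (by fun_prop),
            lintegral_prod _ (by fun_prop), lintegral_prod _ (by fun_prop)]
          simp only [lintegral_const]
          rw [lintegral_mul_const _ (by fun_prop)]
          ring
      _ ≤ 8 * μ univ * (M * E i) / ENNReal.ofReal δ ^ 2 := by gcongr; exact hM i
      _ = _ := by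
          have hδ2 : δ.toNNReal ^ 2 ≠ 0 := by simpa using hδ
          rw [ENNReal.coe_div hδ2]
          push_cast
          rw [ENNReal.coe_toNNReal (measure_ne_top _ _)]
          simp only [div_eq_mul_inv, ENNReal.ofReal]
          ring
  calc gagliardo (μ) (w i) = ∫⁻ p in {p : X × X | δ ≤ dist p.1 p.2} ∪
        ⋃ q : t, Metric.ball (q : X) (r q) ×ˢ Metric.ball (q : X) (r q),
        ‖w i p.1 - w i p.2‖ₑ ^ 2 / edist p.1 p.2 ^ 2 ∂(μ.prod μ) := by
        rw [gagliardo, Measure.restrict_eq_self_of_ae_mem hae]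
    _ ≤ _ := lintegral_union_le _ _ _
    _ ≤ (8 * (μ univ).toNNReal * M / δ.toNNReal ^ 2 : ℝ≥0) * E i + ∑ p : t, C p * E i := by
        gcongr
        refine (lintegral_iUnion_le _ _).trans ?_
        rw [tsum_fintype]
        refine Finset.sum_le_sum fun q _ => ?_
        rw [← gagliardo_restrict]
        exact hC _ q.1.2 i
    _ = _ := by
        push_cast
        rw [← Finset.sum_mul, add_mul]

end Gagliardo

/-! ### Regularized Riesz potentials of a measure -/

theorem lintegral_mul_sq_le {α : Type*} [MeasurableSpace α] (μ : Measure α) {f g : α → ℝ≥0∞}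
    (hf : AEMeasurable f μ) (hg : AEMeasurable g μ) :
    (∫⁻ a, f a * g a ∂μ) ^ 2 ≤ (∫⁻ a, f a ^ 2 ∂μ) * ∫⁻ a, g a ^ 2 ∂μ := by
  have h := ENNReal.lintegral_mul_le_Lp_mul_Lq μ Real.HolderConjugate.two_two hf hg
  calc _ ≤ ((∫⁻ a, f a ^ (2 : ℝ) ∂μ) ^ (1 / 2 : ℝ) * (∫⁻ a, g a ^ (2 : ℝ) ∂μ) ^ (1 / 2 : ℝ)) ^ 2 :=
        pow_le_pow_left' h 2
    _ = _ := by
        rw [mul_pow, ← ENNReal.rpow_natCast, ← ENNReal.rpow_natCast, ← ENNReal.rpow_mul,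
          ← ENNReal.rpow_mul]
        simp

theorem lintegral_sq_le {α : Type*} [MeasurableSpace α] (μ : Measure α) {f : α → ℝ≥0∞}
    (hf : AEMeasurable f μ) : (∫⁻ a, f a ∂μ) ^ 2 ≤ μ univ * ∫⁻ a, f a ^ 2 ∂μ := by
  simpa using lintegral_mul_sq_le μ (aemeasurable_const (b := (1 : ℝ≥0∞))) hf

section Potential

variable {X : Type*} [MetricSpace X] {𝕜 : Type*} [RCLike 𝕜]

/-- The weight `|x - y| ^ (-1/2)`, with value `∞` on the diagonal. -/
noncomputable def rieszWeight (x y : X) : ℝ≥0∞ := (edist x y ^ (1 / 2 : ℝ))⁻¹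

theorem rieszWeight_comm (x y : X) : rieszWeight x y = rieszWeight y x := by
  rw [rieszWeight, rieszWeight, edist_comm]

theorem ofReal_inv_sqrt_dist_le (x y : X) :
    ENNReal.ofReal (√(dist x y))⁻¹ ≤ rieszWeight x y := by
  rcases eq_or_ne x y with rfl | hxy
  · simp
  have hd : 0 < dist x y := dist_pos.2 hxy
  rw [ENNReal.ofReal_inv_of_pos (Real.sqrt_pos.2 hd), rieszWeight, edist_dist, Real.sqrt_eq_rpow,
    ENNReal.ofReal_rpow_of_pos hd]

theorem IsRieszKernel.enorm_le_rieszWeight {A : ℝ} {κ : ℝ → ℝ} (h : IsRieszKernel A κ) (x y : X) :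
    ‖κ (dist x y)‖ₑ ≤ rieszWeight x y := by
  rcases eq_or_ne x y with rfl | hxy
  · simp [rieszWeight]
  refine le_trans ?_ (ofReal_inv_sqrt_dist_le x y)
  rw [Real.enorm_eq_ofReal_abs]
  exact ENNReal.ofReal_le_ofReal (h.abs_le _ (dist_pos.2 hxy))

variable [MeasurableSpace X]

/-- The potential of `f` for a radial kernel. -/
noncomputable def potential (μ : Measure X) (κ : ℝ → ℝ) (f : X → 𝕜) (x : X) : 𝕜 :=
  ∫ y, κ (dist x y) • f y ∂μ

variable [BorelSpace X]

theorem measurable_rieszWeight_right (x : X) : Measurable fun y => rieszWeight x y := by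
  unfold rieszWeight
  fun_prop

namespace IsRieszKernel

variable {A : ℝ} {κ : ℝ → ℝ} {μ : Measure X} {f : X → 𝕜}

theorem integrable_smul (h : IsRieszKernel A κ) (hf : Integrable f μ) (x : X) :
    Integrable (fun y => κ (dist x y) • f y) μ := by
  obtain ⟨B, hB⟩ := h.exists_bound
  have hc := h.continuous
  exact hf.bdd_smul B (by fun_prop : Continuous fun y => κ (dist x y)).aestronglyMeasurable
    (.of_forall fun t => hB _ dist_nonneg)

theorem continuous_potential (h : IsRieszKernel A κ) (hf : Integrable f μ) :
    Continuous (potential μ κ f) := by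
  obtain ⟨B, hB⟩ := h.exists_bound
  have hc := h.continuous
  refine continuous_of_dominated (bound := fun y => B * ‖f y‖)
    (fun x => (h.integrable_smul hf x).aestronglyMeasurable) (fun x => .of_forall fun y => ?_)
    (hf.norm.const_mul B) (.of_forall fun y => by fun_prop)
  rw [norm_smul]
  gcongr
  exact hB _ dist_nonneg

theorem potential_add (h : IsRieszKernel A κ) {g : X → 𝕜} (hf : Integrable f μ)
    (hg : Integrable g μ) : potential μ κ (f + g) = potential μ κ f + potential μ κ g := by
  ext x
  simp only [potential, Pi.add_apply, smul_add]
  exact integral_add (h.integrable_smul hf x) (h.integrable_smul hg x)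

/-- Points of the ball are at distance at least `r` from the support of `f`, where the kernel is
Lipschitz with constant `A r^{-3/2}`. -/
theorem enorm_potential_sub_le (h : IsRieszKernel A κ) (hf : Integrable f μ) {p : X} {r : ℝ}
    (hr : 0 < r) (hfp : ∀ y ∈ Metric.ball p (2 * r), f y = 0) {x x' : X}
    (hx : x ∈ Metric.ball p r) (hx' : x' ∈ Metric.ball p r) :
    ‖potential μ κ f x - potential μ κ f x'‖ₑ ≤
      ENNReal.ofReal (A / (r * √r)) * (∫⁻ y, ‖f y‖ₑ ∂μ) * edist x x' := by
  have hA := h.nonneg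
  rw [potential, potential, ← integral_sub (h.integrable_smul hf x) (h.integrable_smul hf x')]
  refine (enorm_integral_le_lintegral_enorm _).trans ?_
  rw [mul_right_comm, ← lintegral_const_mul'' _ hf.aestronglyMeasurable.enorm]
  refine lintegral_mono fun y => ?_
  rw [← sub_smul, enorm_smul]
  by_cases hy : y ∈ Metric.ball p (2 * r)
  · simp [hfp y hy]
  have far : ∀ z ∈ Metric.ball p r, r ≤ dist z y := fun z hz => by
    rw [Metric.mem_ball] at hz hy
    have := dist_triangle y z p
    rw [dist_comm z y]
    linarith
  gcongr
  rw [Real.enorm_eq_ofReal_abs, edist_dist, ← ENNReal.ofReal_mul (by positivity)]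
  refine ENNReal.ofReal_le_ofReal ((h.abs_sub_le' hr (far x hx) (far x' hx')).trans ?_)
  rw [mul_div_right_comm]
  gcongr
  exact abs_dist_sub_le x x' y

/-- Cauchy–Schwarz after writing the weight as a product of its square roots; this is the pointwise
half of Schur's test. -/
theorem enorm_potential_sq_le (h : IsRieszKernel A κ) (hf : AEStronglyMeasurable f μ) (x : X) :
    ‖potential μ κ f x‖ₑ ^ 2 ≤
      (∫⁻ y, rieszWeight x y ∂μ) * ∫⁻ y, rieszWeight x y * ‖f y‖ₑ ^ 2 ∂μ := by
  have e : ∀ a : ℝ≥0∞, (a ^ (1 / 2 : ℝ)) ^ 2 = a := fun a => by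
    rw [← ENNReal.rpow_natCast, ← ENNReal.rpow_mul]; simp
  have h1 : ‖potential μ κ f x‖ₑ ≤
      ∫⁻ y, rieszWeight x y ^ (1 / 2 : ℝ) * (rieszWeight x y ^ (1 / 2 : ℝ) * ‖f y‖ₑ) ∂μ := by
    refine (enorm_integral_le_lintegral_enorm _).trans (lintegral_mono fun y => ?_)
    rw [enorm_smul, ← mul_assoc, ← sq, e]
    exact mul_le_mul_left (h.enorm_le_rieszWeight x y) _
  have ha : AEMeasurable (fun y => rieszWeight x y ^ (1 / 2 : ℝ)) μ :=
    ((measurable_rieszWeight_right x).pow_const _).aemeasurable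
  have hb : AEMeasurable (fun y => rieszWeight x y ^ (1 / 2 : ℝ) * ‖f y‖ₑ) μ := ha.mul hf.enorm
  have h2 := lintegral_mul_sq_le μ ha hb
  simp only [mul_pow, e] at h2
  exact (pow_le_pow_left' h1 2).trans h2

/-- The seminorm of the potential of a function vanishing near `p` is bounded near `p`. -/
theorem gagliardo_potential_le_of_eq_zero [SFinite μ] (h : IsRieszKernel A κ) (hf : Integrable f μ)
    {p : X} {r : ℝ} (hr : 0 < r) (hfp : ∀ y ∈ Metric.ball p (2 * r), f y = 0) :
    gagliardo (μ.restrict (Metric.ball p r)) (potential μ κ f) ≤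
      ENNReal.ofReal (A / (r * √r)) ^ 2 * μ univ ^ 3 * ∫⁻ x, ‖f x‖ₑ ^ 2 ∂μ := by
  refine (gagliardo_restrict_le_of_lipschitz μ fun x hx y hy =>
    h.enorm_potential_sub_le hf hr hfp hx hy).trans ?_
  rw [mul_pow]
  calc _ ≤ ENNReal.ofReal (A / (r * √r)) ^ 2 * (μ univ * ∫⁻ y, ‖f y‖ₑ ^ 2 ∂μ) *
        (μ univ * μ univ) := by
        gcongr; exact lintegral_sq_le μ hf.aestronglyMeasurable.enorm
    _ = _ := by ring

end IsRieszKernel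

variable [SecondCountableTopology X]

@[fun_prop]
theorem measurable_rieszWeight :
    Measurable fun p : X × X => rieszWeight p.1 p.2 := by
  unfold rieszWeight
  fun_prop

namespace IsRieszKernel

variable {A : ℝ} {κ : ℝ → ℝ} {μ : Measure X} {f : X → 𝕜}

theorem lintegral_lintegral_rieszWeight_mul_le [SFinite μ] {g : X → ℝ≥0∞} (hg : AEMeasurable g μ)
    {M : ℝ≥0∞} (hM : ∀ x, ∫⁻ y, rieszWeight x y ∂μ ≤ M) :
    ∫⁻ x, ∫⁻ y, rieszWeight x y * g y ∂μ ∂μ ≤ M * ∫⁻ x, g x ∂μ := by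
  have hg2 : AEMeasurable (fun p : X × X => g p.2) (μ.prod μ) :=
    hg.comp_quasiMeasurePreserving Measure.quasiMeasurePreserving_snd
  have hprod : AEMeasurable (Function.uncurry fun x y => rieszWeight x y * g y) (μ.prod μ) :=
    measurable_rieszWeight.aemeasurable.mul hg2
  rw [lintegral_lintegral_swap hprod, ← lintegral_const_mul'' _ hg]
  refine lintegral_mono fun y => ?_
  simp_rw [rieszWeight_comm _ y]
  rw [lintegral_mul_const _ (measurable_rieszWeight_right y)]
  exact mul_le_mul_left (hM y) _

theorem lintegral_enorm_potential_sq_le [SFinite μ] (h : IsRieszKernel A κ)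
    (hf : AEStronglyMeasurable f μ) {M : ℝ≥0} (hM : ∀ x, ∫⁻ y, rieszWeight x y ∂μ ≤ M) :
    ∫⁻ x, ‖potential μ κ f x‖ₑ ^ 2 ∂μ ≤ M ^ 2 * ∫⁻ x, ‖f x‖ₑ ^ 2 ∂μ := by
  calc _ ≤ ∫⁻ x, M * ∫⁻ y, rieszWeight x y * ‖f y‖ₑ ^ 2 ∂μ ∂μ :=
        lintegral_mono fun x => (h.enorm_potential_sq_le hf x).trans (mul_le_mul_left (hM x) _)
    _ = M * ∫⁻ x, ∫⁻ y, rieszWeight x y * ‖f y‖ₑ ^ 2 ∂μ ∂μ :=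
        lintegral_const_mul' _ _ ENNReal.coe_ne_top
    _ ≤ M * (M * ∫⁻ y, ‖f y‖ₑ ^ 2 ∂μ) :=
        mul_le_mul_right (lintegral_lintegral_rieszWeight_mul_le (hf.enorm.pow_const 2) hM) _
    _ = _ := by ring

/-- The seminorm of the potential of a function on a subset of a line. -/
theorem gagliardo_potential_le_of_isometry (h : IsRieszKernel A κ) {Γ V : Set X}
    (hΓ : MeasurableSet Γ) (hV : MeasurableSet V) {γ : ℝ → X} (hγ : Isometry γ)
    (hsub : Γ ∩ V ⊆ range γ) (hf : Integrable f ((μH[1]).restrict Γ))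
    (hf2 : MemLp f 2 ((μH[1]).restrict Γ)) (hfV : ∀ y ∉ V, f y = 0) :
    gagliardo (((μH[1]).restrict Γ).restrict V) (potential ((μH[1]).restrict Γ) κ f) ≤
      ENNReal.ofReal (8 * Real.pi ^ 2 + 8) * ENNReal.ofReal ((8 * √3 + 8 * A) ^ 2 / 8) *
        ∫⁻ x, ‖f x‖ₑ ^ 2 ∂(μH[1]).restrict Γ := by
  have hme : MeasurableEmbedding γ := hγ.isClosedEmbedding.measurableEmbedding
  set ρ : Measure ℝ := volume.restrict (γ ⁻¹' (Γ ∩ V)) with hρ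
  have hS : MeasurableSet (Γ ∩ V) := hΓ.inter hV
  have hT : MeasurableSet (γ ⁻¹' (Γ ∩ V)) := hme.measurable hS
  -- An isometry carries Lebesgue measure on `ℝ` to arc length on its range, so this piece of `Γ`
  -- becomes a measurable subset of `ℝ`.
  have hmap : ((μH[1]).restrict Γ).restrict V = Measure.map γ ρ := by
    rw [hρ, ← hme.restrict_map, ← hausdorffMeasure_real, hγ.map_hausdorffMeasure (.inl zero_le_one),
      Measure.restrict_restrict hV, inter_comm V, Measure.restrict_restrict_of_subset hsub]
  -- Extending by zero makes the potential along `γ` a convolution on all of `ℝ`; the integrals over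
  -- the subset are then bounded by those over `ℝ`.
  set U : ℝ → 𝕜 := (γ ⁻¹' (Γ ∩ V)).indicator (f ∘ γ) with hU
  have hfi : Integrable f (Measure.map γ ρ) := hmap ▸ hf.restrict
  have hfi2 : MemLp f 2 (Measure.map γ ρ) := hmap ▸ hf2.restrict V
  have hUi : Integrable U := by
    rw [hU, integrable_indicator_iff hT]
    exact (hme.integrable_map_iff).1 hfi
  have hUi2 : MemLp U 2 := by
    rw [hU, memLp_indicator_iff_restrict hT]
    exact (memLp_map_measure_iff hfi2.1 hme.measurable.aemeasurable).1 hfi2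
  have hpot : ∀ s, potential ((μH[1]).restrict Γ) κ f (γ s) = ∫ t, κ |s - t| • U t := by
    intro s
    have e1 : ∫ y, κ (dist (γ s) y) • f y ∂(μH[1]).restrict Γ =
        ∫ y in V, κ (dist (γ s) y) • f y ∂(μH[1]).restrict Γ :=
      (setIntegral_eq_integral_of_forall_compl_eq_zero fun y hy => by
        rw [hfV y hy, smul_zero]).symm
    rw [potential, e1, hmap, hme.integral_map, hρ, ← integral_indicator hT]
    refine integral_congr_ae (.of_forall fun t => ?_)
    simp only [hU, indicator, Function.comp_apply, hγ.dist_eq, Real.dist_eq]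
    split_ifs <;> simp
  have hpc := h.continuous_potential hf
  calc gagliardo (((μH[1]).restrict Γ).restrict V) (potential ((μH[1]).restrict Γ) κ f)
      = ∫⁻ x, ∫⁻ y, ‖(∫ t, κ |x - t| • U t) - ∫ t, κ |y - t| • U t‖ₑ ^ 2 / edist x y ^ 2 ∂ρ ∂ρ := by
        rw [hmap, gagliardo, lintegral_prod _ (by fun_prop), hme.lintegral_map]
        simp_rw [hme.lintegral_map, hpot, hγ.edist_eq]
    _ ≤ ∫⁻ x, ∫⁻ y, ‖(∫ t, κ |x - t| • U t) - ∫ t, κ |y - t| • U t‖ₑ ^ 2 / edist x y ^ 2 :=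
        lintegral_mono' Measure.restrict_le_self fun x =>
          lintegral_mono' Measure.restrict_le_self le_rfl
    _ ≤ _ := h.lintegral_lintegral_le hUi hUi2
    _ ≤ _ := by
        gcongr
        have e2 : ∫⁻ t, ‖U t‖ₑ ^ 2 = ∫⁻ y in V, ‖f y‖ₑ ^ 2 ∂(μH[1]).restrict Γ := by
          rw [hmap, hme.lintegral_map, hρ, ← lintegral_indicator hT]
          refine lintegral_congr fun t => ?_
          simp only [hU, indicator, Function.comp_apply]
          split_ifs <;> simp
        rw [e2]
        exact setLIntegral_le_lintegral _ _

end IsRieszKernel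

end Potential

/-! ### Polygonal boundaries -/

section Lines

variable {E : Type*} [NormedAddCommGroup E] [InnerProductSpace ℝ E]

theorem isometry_add_smul (p : E) {e : E} (he : ‖e‖ = 1) : Isometry fun t : ℝ => p + t • e :=
  Isometry.of_dist_eq fun s t => by
    rw [dist_add_left, dist_eq_norm, ← sub_smul, norm_smul, he, mul_one, Real.dist_eq,
      Real.norm_eq_abs]

/-- Orthogonal projection onto the line does not increase distances. This reduces potentials of a
segment at any `x` to the case where `x` is on the line. -/
theorem abs_sub_inner_le_dist (x p : E) {e : E} (he : ‖e‖ = 1) (t : ℝ) :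
    |t - inner ℝ (x - p) e| ≤ dist x (p + t • e) := by
  have h : inner ℝ (p + t • e - x) e = t - inner ℝ (x - p) e := by
    rw [show p + t • e - x = t • e - (x - p) by abel, inner_sub_left, inner_smul_left,
      real_inner_self_eq_norm_sq, he]
    simp
  rw [← h, dist_comm, dist_eq_norm]
  simpa [he] using abs_real_inner_le_norm (p + t • e - x) e

theorem exists_isometry_of_collinear [Nontrivial E] {s : Set E} (hs : Collinear ℝ s) :
    ∃ γ : ℝ → E, Isometry γ ∧ s ⊆ range γ := by
  obtain ⟨p, v, hv⟩ := (collinear_iff_exists_forall_eq_smul_vadd (k := ℝ) s).1 hs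
  by_cases hv0 : v = 0
  · obtain ⟨e, he⟩ := exists_norm_eq E zero_le_one
    refine ⟨_, isometry_add_smul p he, fun x hx => ⟨0, ?_⟩⟩
    obtain ⟨r, rfl⟩ := hv x hx
    simp [hv0]
  · have hn : ‖v‖ ≠ 0 := norm_ne_zero_iff.2 hv0
    refine ⟨_, isometry_add_smul p (e := ‖v‖⁻¹ • v) (norm_smul_inv_norm (𝕜 := ℝ) hv0),
      fun x hx => ?_⟩
    obtain ⟨r, rfl⟩ := hv x hx
    refine ⟨r * ‖v‖, ?_⟩
    simp only [smul_smul, mul_assoc, mul_inv_cancel₀ hn, mul_one, vadd_eq_add, add_comm]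

variable [MeasurableSpace E] [BorelSpace E]

theorem lintegral_segment_rieszWeight_le (a b : E) :
    ∀ x, ∫⁻ y in segment ℝ a b, rieszWeight x y ∂μH[1] ≤ (4 + nndist a b : ℝ≥0) := by
  intro x
  rcases eq_or_ne a b with rfl | hab
  · have : μH[1] (segment ℝ a a) = 0 := by rw [hausdorffMeasure_segment, edist_self]
    rw [Measure.restrict_eq_zero.2 this]
    simp
  have hn : ‖b - a‖ ≠ 0 := norm_ne_zero_iff.2 (sub_ne_zero.2 hab.symm)
  set e : E := ‖b - a‖⁻¹ • (b - a)
  have he : ‖e‖ = 1 := norm_smul_inv_norm (𝕜 := ℝ) (sub_ne_zero.2 hab.symm)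
  set γ : ℝ → E := fun t => a + t • e with hγdef
  have hγ : Isometry γ := isometry_add_smul a he
  have hme : MeasurableEmbedding γ := hγ.isClosedEmbedding.measurableEmbedding
  have hseg : segment ℝ a b = γ '' Icc 0 ‖b - a‖ := by
    rw [segment_eq_image']
    ext y
    constructor
    · rintro ⟨θ, hθ, rfl⟩
      refine ⟨θ * ‖b - a‖, ⟨by have := hθ.1; positivity,
        mul_le_of_le_one_left (norm_nonneg _) hθ.2⟩, ?_⟩
      simp only [hγdef, e, smul_smul, mul_assoc, mul_inv_cancel₀ hn, mul_one]
    · rintro ⟨t, ht, rfl⟩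
      refine ⟨t * ‖b - a‖⁻¹, ⟨mul_nonneg ht.1 (by positivity), ?_⟩, ?_⟩
      · rw [← div_eq_mul_inv]
        exact div_le_one_of_le₀ ht.2 (norm_nonneg _)
      · simp only [hγdef, e, smul_smul]
  have hmap : (μH[1]).restrict (segment ℝ a b) =
      Measure.map γ (volume.restrict (Icc 0 ‖b - a‖)) := by
    have hS : MeasurableSet (γ '' Icc 0 ‖b - a‖) := hme.measurableSet_image.2 measurableSet_Icc
    rw [hseg, ← Measure.restrict_restrict_of_subset (image_subset_range γ _),
      ← hγ.map_hausdorffMeasure (.inl zero_le_one), hausdorffMeasure_real,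
      hme.restrict_map, preimage_image_eq _ hγ.injective]
  rw [hmap, hme.lintegral_map]
  set t₀ : ℝ := inner ℝ (x - a) e
  -- With `t₀` the projection of `x`, the singularity within distance `1` integrates to at most `4`;
  -- beyond it the weight is at most `1` and contributes at most the length.
  have hpt : ∀ᵐ t : ℝ, rieszWeight x (γ t) ≤
      (Iic 1).indicator (fun s => ENNReal.ofReal (√s)⁻¹) |t - t₀| + 1 := by
    have h0 : ∀ᵐ t : ℝ, t ≠ t₀ := by simp [ae_iff]
    filter_upwards [h0] with t ht
    have ht' : 0 < |t - t₀| := abs_pos.2 (sub_ne_zero.2 ht)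
    have h1 : rieszWeight x (γ t) ≤ ENNReal.ofReal (√|t - t₀|)⁻¹ := by
      rw [ENNReal.ofReal_inv_of_pos (Real.sqrt_pos.2 ht'), rieszWeight, Real.sqrt_eq_rpow,
        ← ENNReal.ofReal_rpow_of_pos ht', edist_dist]
      gcongr
      exact abs_sub_inner_le_dist x a he t
    refine h1.trans ?_
    rcases le_or_gt |t - t₀| 1 with hle | hlt
    · rw [indicator_of_mem (mem_Iic.2 hle)]
      exact le_self_add
    · refine le_add_left ?_
      rw [← ENNReal.ofReal_one]
      refine ENNReal.ofReal_le_ofReal (inv_le_one_of_one_le₀ ?_)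
      rw [← Real.sqrt_one]
      exact Real.sqrt_le_sqrt hlt.le
  calc _ ≤ ∫⁻ t in Icc 0 ‖b - a‖,
        ((Iic 1).indicator (fun s => ENNReal.ofReal (√s)⁻¹) |t - t₀| + 1) :=
        lintegral_mono_ae (ae_restrict_of_ae hpt)
    _ = (∫⁻ t in Icc 0 ‖b - a‖, (Iic 1).indicator (fun s => ENNReal.ofReal (√s)⁻¹) |t - t₀|) +
          ENNReal.ofReal ‖b - a‖ := by
        rw [lintegral_add_right _ measurable_const]
        simp
    _ ≤ (∫⁻ t, (Iic 1).indicator (fun s => ENNReal.ofReal (√s)⁻¹) |t - t₀|) +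
          ENNReal.ofReal ‖b - a‖ := by
        gcongr
        exact Measure.restrict_le_self
    _ = _ := by
        rw [lintegral_sub_right_eq_self
          (fun t => (Iic 1).indicator (fun s => ENNReal.ofReal (√s)⁻¹) |t|) t₀,
          lintegral_inv_sqrt_abs zero_le_one, ← dist_eq_norm, dist_comm b a, ← edist_dist, edist_nndist]
        simp

end Lines

/-! ### Length, weights and corners of the boundary -/

theorem IsPolygonalDomain.isCompact_frontier {Ω : Set Plane} (hΩ : IsPolygonalDomain Ω) :
    IsCompact (frontier Ω) :=
  Metric.isCompact_of_isClosed_isBounded isClosed_frontier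
    (hΩ.isBounded.closure.subset frontier_subset_closure)

theorem IsPolygonalDomain.isFiniteMeasure {Ω : Set Plane} (hΩ : IsPolygonalDomain Ω) :
    IsFiniteMeasure (arcLength (frontier Ω)) := by
  obtain ⟨S, hS⟩ := hΩ.boundary_segments
  refine ⟨?_⟩
  rw [arcLength, Measure.restrict_apply_univ, hS]
  refine (measure_biUnion_finset_le S _).trans_lt (ENNReal.sum_lt_top.2 fun s _ => ?_)
  rw [hausdorffMeasure_segment]
  exact edist_lt_top _ _

theorem IsPolygonalDomain.exists_lintegral_rieszWeight_le {Ω : Set Plane}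
    (hΩ : IsPolygonalDomain Ω) :
    ∃ M : ℝ≥0, ∀ x, ∫⁻ y, rieszWeight x y ∂arcLength (frontier Ω) ≤ M := by
  obtain ⟨S, hS⟩ := hΩ.boundary_segments
  refine ⟨∑ s : S, (4 + nndist s.1.1 s.1.2), fun x => ?_⟩
  have hS' : frontier Ω = ⋃ s : S, segment ℝ s.1.1 s.1.2 := by rw [hS, iUnion_subtype]
  rw [arcLength, hS']
  refine (lintegral_iUnion_le _ _).trans ?_
  rw [tsum_fintype, ENNReal.ofNNReal_finsetSum]
  exact Finset.sum_le_sum fun s _ => lintegral_segment_rieszWeight_le _ _ x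

theorem exists_isometry_of_not_isCorner {Ω : Set Plane} {p : Plane} (hp : p ∈ frontier Ω)
    (hc : ¬ IsCorner Ω p) :
    ∃ r > 0, ∃ γ : ℝ → Plane, Isometry γ ∧ frontier Ω ∩ Metric.ball p (2 * r) ⊆ range γ := by
  simp only [IsCorner, hp, true_and, not_forall, not_not] at hc
  obtain ⟨r, hr, hcol⟩ := hc
  refine ⟨r / 2, by positivity, ?_⟩
  rw [mul_div_cancel₀ r two_ne_zero]
  exact exists_isometry_of_collinear hcol

/-- A corner lies in no disk of the cover but the one centred at it, so a corner common to both
disks would force them to be equal and centred there. -/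
theorem IsDiskCover.not_isCorner {Ω : Set Plane} {P : Finset Disk} (hP : IsDiskCover Ω P)
    {D D' : Disk} (hD : D ∈ P) (hD' : D' ∈ P)
    (h : D ≠ D' ∨ (D = D' ∧ ¬ IsCorner Ω D.centre)) {p : Plane} (hp : p ∈ D.carrier)
    (hp' : p ∈ D'.carrier) : ¬ IsCorner Ω p := by
  intro hc
  obtain ⟨D₀, -, hcen, hother⟩ := hP.corner p hc
  have e : ∀ D₁ ∈ P, p ∈ D₁.carrier → D₁ = D₀ := fun D₁ h₁ hp₁ => by
    by_contra hne
    exact hother D₁ h₁ hne (subset_closure hp₁)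
  rcases h with hne | ⟨-, hnc⟩
  · exact hne ((e D hD hp).trans (e D' hD' hp').symm)
  · rw [e D hD hp, hcen] at hnc
    exact hnc hc

/-! ### Regularization of the Riesz kernel -/

/-- A smooth even cutoff which is `1` on `[-ρ, ρ]` and `0` outside `(-2ρ, 2ρ)`. -/
noncomputable def radialCutoff (ρ r : ℝ) : ℝ := Real.smoothTransition (2 - r ^ 2 / ρ ^ 2)

/-- A smooth compactly supported approximation of `r ↦ r ^ (-1/2)`. -/
noncomputable def regularizedKernel (ρ ε r : ℝ) : ℝ := (√√(ε + r ^ 2))⁻¹ * radialCutoff ρ r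

theorem radialCutoff_eq_one {ρ r : ℝ} (hρ : 0 < ρ) (hr : |r| ≤ ρ) : radialCutoff ρ r = 1 := by
  refine Real.smoothTransition.one_of_one_le ?_
  have : r ^ 2 / ρ ^ 2 ≤ 1 := by
    rw [div_le_one (by positivity), ← sq_abs]
    gcongr
  linarith

theorem radialCutoff_eq_zero {ρ r : ℝ} (hρ : 0 < ρ) (hr : 2 * ρ ≤ |r|) : radialCutoff ρ r = 0 := by
  refine Real.smoothTransition.zero_of_nonpos ?_
  have : 2 ≤ r ^ 2 / ρ ^ 2 := by
    rw [le_div_iff₀ (by positivity), ← sq_abs r]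
    nlinarith
  linarith

theorem radialCutoff_abs_le_one (ρ r : ℝ) : |radialCutoff ρ r| ≤ 1 := by
  rw [radialCutoff, abs_of_nonneg (Real.smoothTransition.nonneg _)]
  exact Real.smoothTransition.le_one _

theorem contDiff_radialCutoff (ρ : ℝ) : ContDiff ℝ ∞ (radialCutoff ρ) :=
  Real.smoothTransition.contDiff.comp (by fun_prop)

theorem exists_lipschitzWith_radialCutoff {ρ : ℝ} (hρ : 0 < ρ) :
    ∃ L : ℝ≥0, LipschitzWith L (radialCutoff ρ) := by
  refine ContDiff.lipschitzWith_of_hasCompactSupport ?_ (contDiff_radialCutoff ρ) (by simp)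
  refine HasCompactSupport.intro (isCompact_Icc (a := -(2 * ρ)) (b := 2 * ρ)) fun x hx => ?_
  refine radialCutoff_eq_zero hρ ?_
  by_contra hlt
  exact hx (abs_le.1 (not_le.1 hlt).le)

theorem inv_sqrt_sqrt_le {ε r : ℝ} (hε : 0 < ε) (hr : 0 < r) : (√√(ε + r ^ 2))⁻¹ ≤ (√r)⁻¹ := by
  gcongr
  exact Real.le_sqrt_of_sq_le (by linarith)

/-- With `b`, `c` the two fourth roots, `c⁴ - b⁴ = r² - s²` is free of `ε`. Dividing by `c² + b² ≥ r
+ s` gives `c² - b² ≤ r - s`, and `b`, `c`, `b + c` are all at least `√s`. -/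
theorem abs_inv_sqrt_sqrt_sub_le {ε s r : ℝ} (hε : 0 < ε) (hs : 0 < s) (hsr : s ≤ r) :
    |(√√(ε + r ^ 2))⁻¹ - (√√(ε + s ^ 2))⁻¹| ≤ (r - s) / (s * √s) := by
  set b := √√(ε + s ^ 2)
  set c := √√(ε + r ^ 2)
  set q := √s with hq
  have hq0 : 0 < q := Real.sqrt_pos.2 hs
  have hqb : q ≤ b := Real.sqrt_le_sqrt (Real.le_sqrt_of_sq_le (by linarith))
  have hbc : b ≤ c := Real.sqrt_le_sqrt (Real.sqrt_le_sqrt (by gcongr))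
  have hb0 : 0 < b := hq0.trans_le hqb
  have hc0 : 0 < c := hb0.trans_le hbc
  have hq2 : q ^ 2 = s := Real.sq_sqrt hs.le
  have hb2 : b ^ 2 = √(ε + s ^ 2) := Real.sq_sqrt (Real.sqrt_nonneg _)
  have hc2 : c ^ 2 = √(ε + r ^ 2) := Real.sq_sqrt (Real.sqrt_nonneg _)
  have hb4 : b ^ 2 * b ^ 2 = ε + s ^ 2 := by rw [hb2, Real.mul_self_sqrt (by positivity)]
  have hc4 : c ^ 2 * c ^ 2 = ε + r ^ 2 := by rw [hc2, Real.mul_self_sqrt (by positivity)]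
  have hbs : s ≤ b ^ 2 := by rw [hb2]; exact Real.le_sqrt_of_sq_le (by linarith)
  have hcr : r ≤ c ^ 2 := by rw [hc2]; exact Real.le_sqrt_of_sq_le (by linarith)
  have h1 : (c - b) * (c + b) ≤ r - s := by
    have e : (c - b) * (c + b) * (c ^ 2 + b ^ 2) = (r - s) * (r + s) := by
      linear_combination hc4 - hb4
    have hn : 0 ≤ (c - b) * (c + b) := mul_nonneg (by linarith) (by linarith)
    have : (c - b) * (c + b) * (r + s) ≤ (r - s) * (r + s) := by
      rw [← e]
      gcongr
    exact le_of_mul_le_mul_right this (by linarith)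
  rw [abs_sub_comm, inv_sub_inv hb0.ne' hc0.ne',
    abs_of_nonneg (div_nonneg (by linarith) (by positivity))]
  rw [div_le_div_iff₀ (by positivity) (by positivity)]
  have h2 : s * q ≤ (c + b) * (b * c) := by
    rw [← hq2]
    calc q ^ 2 * q = q * (q * q) := by ring
      _ ≤ (c + b) * (b * c) := by
        gcongr
        · linarith
        · exact hqb.trans hbc
  calc (c - b) * (s * q) ≤ (c - b) * ((c + b) * (b * c)) :=
        mul_le_mul_of_nonneg_left h2 (by linarith)
    _ = (c - b) * (c + b) * (b * c) := by ring
    _ ≤ _ := by gcongr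

theorem isRieszKernel_regularizedKernel {ρ ε : ℝ} (hρ : 0 < ρ) (hε : 0 < ε) {L : ℝ≥0}
    (hL : LipschitzWith L (radialCutoff ρ)) :
    IsRieszKernel (1 + 2 * ρ * L) (regularizedKernel ρ ε) where
  continuous := by
    have := (contDiff_radialCutoff ρ).continuous
    have h : ∀ r : ℝ, √√(ε + r ^ 2) ≠ 0 := fun r => by positivity
    unfold regularizedKernel
    fun_prop (disch := exact h _)
  eq_zero := ⟨2 * ρ, fun r hr => by
    rw [regularizedKernel, radialCutoff_eq_zero hρ (hr.trans (le_abs_self r)), mul_zero]⟩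
  abs_le r hr := by
    rw [regularizedKernel, abs_mul, abs_of_nonneg (by positivity)]
    exact (mul_le_of_le_one_right (by positivity) (radialCutoff_abs_le_one ρ r)).trans
      (inv_sqrt_sqrt_le hε hr)
  abs_sub_le s r hs hsr := by
    have e : regularizedKernel ρ ε r - regularizedKernel ρ ε s =
        ((√√(ε + r ^ 2))⁻¹ - (√√(ε + s ^ 2))⁻¹) * radialCutoff ρ r +
          (√√(ε + s ^ 2))⁻¹ * (radialCutoff ρ r - radialCutoff ρ s) := by
      unfold regularizedKernel; ring
    have hq : 0 < √s := Real.sqrt_pos.2 hs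
    have h0 : 0 ≤ (r - s) / (s * √s) := div_nonneg (by linarith) (by positivity)
    have h1 : |((√√(ε + r ^ 2))⁻¹ - (√√(ε + s ^ 2))⁻¹) * radialCutoff ρ r| ≤
        (r - s) / (s * √s) := by
      rw [abs_mul]
      exact (mul_le_of_le_one_right (abs_nonneg _) (radialCutoff_abs_le_one ρ r)).trans
        (abs_inv_sqrt_sqrt_sub_le hε hs hsr)
    have h2 : |(√√(ε + s ^ 2))⁻¹ * (radialCutoff ρ r - radialCutoff ρ s)| ≤
        2 * ρ * L * ((r - s) / (s * √s)) := by
      -- Beyond `2ρ` the cutoff vanishes at both points; otherwise `s < 2ρ` trades `s^{-1/2}` for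
      -- `2ρ s^{-3/2}`. Neither case involves `ε`.
      rcases le_or_gt (2 * ρ) s with h | h
      · rw [radialCutoff_eq_zero hρ (h.trans (le_abs_self s)),
          radialCutoff_eq_zero hρ ((h.trans hsr).trans (le_abs_self r)), sub_zero, mul_zero,
          abs_zero]
        positivity
      · have hl := hL.dist_le_mul r s
        rw [Real.dist_eq, Real.dist_eq, abs_of_nonneg (sub_nonneg.2 hsr)] at hl
        rw [abs_mul, abs_of_nonneg (by positivity)]
        calc _ ≤ (√s)⁻¹ * (L * (r - s)) := by
              exact mul_le_mul (inv_sqrt_sqrt_le hε hs) hl (abs_nonneg _) (by positivity)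
          _ = s * L * ((r - s) / (s * √s)) := by field_simp
          _ ≤ _ := by gcongr
    rw [e]
    refine (abs_add_le _ _).trans ((add_le_add h1 h2).trans (le_of_eq ?_))
    ring

theorem tendsto_regularizedKernel {ρ r : ℝ} (hρ : 0 < ρ) (hr : 0 < r) (hrρ : r ≤ ρ) :
    Filter.Tendsto (fun n : ℕ => regularizedKernel ρ (1 / ((n : ℝ) + 1)) r) Filter.atTop
      (nhds (√r)⁻¹) := by
  have h1 : radialCutoff ρ r = 1 := radialCutoff_eq_one hρ (by rwa [abs_of_pos hr])
  simp only [regularizedKernel, h1, mul_one]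
  have e : √r = √√(0 + r ^ 2) := by rw [zero_add, Real.sqrt_sq hr.le]
  rw [e]
  have hne : √√(0 + r ^ 2) ≠ 0 := by rw [← e]; positivity
  have ht := (tendsto_one_div_add_atTop_nhds_zero_nat (𝕜 := ℝ)).add_const (r ^ 2)
  exact (((Real.continuous_sqrt.comp Real.continuous_sqrt).tendsto _).comp ht).inv₀ hne

-- The kernel is a smooth function of `‖z‖ ^ 2` with compact support, so the potential is a
-- convolution with a smooth function.
open scoped Convolution in
theorem contDiff_potential_regularizedKernel {𝕜 : Type*} [RCLike 𝕜] {E : Type*}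
    [NormedAddCommGroup E] [InnerProductSpace ℝ E] [FiniteDimensional ℝ E] [MeasurableSpace E]
    [BorelSpace E] {μ : Measure E} {f : E → 𝕜} (hf : LocallyIntegrable f μ) {ρ ε : ℝ}
    (hρ : 0 < ρ) (hε : 0 < ε) :
    ContDiff ℝ ∞ (potential μ (regularizedKernel ρ ε) f) := by
  have hK : ContDiff ℝ ∞ fun z : E => regularizedKernel ρ ε ‖z‖ := by
    unfold regularizedKernel radialCutoff
    have h2 : ContDiff ℝ ∞ fun z : E => ‖z‖ ^ 2 := contDiff_norm_sq ℝ
    have h3 : ∀ z : E, ε + ‖z‖ ^ 2 ≠ 0 := fun z => by positivity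
    have h4 : ∀ z : E, √(ε + ‖z‖ ^ 2) ≠ 0 := fun z => by positivity
    have h5 : ∀ z : E, √√(ε + ‖z‖ ^ 2) ≠ 0 := fun z => by positivity
    exact ((((contDiff_const.add h2).sqrt h3).sqrt h4).inv h5).mul
      (Real.smoothTransition.contDiff.comp (contDiff_const.sub (h2.div_const _)))
  have hKs : HasCompactSupport fun z : E => regularizedKernel ρ ε ‖z‖ := by
    refine HasCompactSupport.intro (isCompact_closedBall (0 : E) (2 * ρ)) fun z hz => ?_
    rw [mem_closedBall_zero_iff, not_le] at hz
    rw [regularizedKernel, radialCutoff_eq_zero hρ (by rw [abs_norm]; exact hz.le), mul_zero]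
  have h := hKs.contDiff_convolution_right (n := ⊤) (μ := μ)
    (ContinuousLinearMap.lsmul ℝ ℝ : ℝ →L[ℝ] 𝕜 →L[ℝ] 𝕜).flip hf hK
  convert h using 1
  ext x
  simp [potential, convolution_def, dist_eq_norm]

/-! ### The `H^{1/2}` bound -/

section Bounds

variable {𝕜 : Type*} [RCLike 𝕜]

theorem eLpNorm_two_sq {α : Type*} [MeasurableSpace α] (μ : Measure α) (f : α → 𝕜) :
    eLpNorm f 2 μ ^ 2 = ∫⁻ x, ‖f x‖ₑ ^ 2 ∂μ := by
  simpa using eLpNorm_nnreal_pow_eq_lintegral (f := f) (μ := μ) (p := 2) (by norm_num)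

theorem exists_enorm_le_of_hasCompactSupport {E : Type*} [TopologicalSpace E] {χ : E → ℝ}
    (hc : Continuous χ) (hs : HasCompactSupport χ) : ∃ B : ℝ≥0, ∀ x, ‖χ x‖ₑ ≤ B := by
  obtain ⟨B, hB⟩ := hs.exists_bound_of_continuous hc
  refine ⟨B.toNNReal, fun x => ?_⟩
  rw [← ofReal_norm]
  exact ENNReal.ofReal_le_ofReal (hB x)

/-- The local bound for the potential of functions vanishing outside a closed set `F`, away from the
corners of `F`. -/
theorem exists_gagliardo_potential_le {Ω : Set Plane} (hΩ : IsPolygonalDomain Ω) {F : Set Plane}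
    (hF : IsClosed F) (A : ℝ) {p : Plane} (hp : p ∈ frontier Ω) (hpF : p ∉ F ∨ ¬ IsCorner Ω p) :
    ∃ r > 0, ∃ C : ℝ≥0, ∀ (κ : ℝ → ℝ) (f : Plane → 𝕜), IsRieszKernel A κ →
      Integrable f (arcLength (frontier Ω)) → MemLp f 2 (arcLength (frontier Ω)) →
      (∀ y ∉ F, f y = 0) →
      gagliardo ((arcLength (frontier Ω)).restrict (Metric.ball p r))
        (potential (arcLength (frontier Ω)) κ f) ≤
        C * ∫⁻ x, ‖f x‖ₑ ^ 2 ∂arcLength (frontier Ω) := by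
  have := hΩ.isFiniteMeasure
  set σ := arcLength (frontier Ω) with hσ
  have hcoe : ∀ r : ℝ, ((ENNReal.ofReal (A / (r * √r)) ^ 2 * σ univ ^ 3).toNNReal : ℝ≥0∞) =
      ENNReal.ofReal (A / (r * √r)) ^ 2 * σ univ ^ 3 := fun r =>
    ENNReal.coe_toNNReal (by finiteness)
  rcases hpF with hpF | hpc
  · obtain ⟨r, hr, hball⟩ := Metric.isOpen_iff.1 hF.isOpen_compl p hpF
    refine ⟨r / 2, by positivity,
      (ENNReal.ofReal (A / (r / 2 * √(r / 2))) ^ 2 * σ univ ^ 3).toNNReal,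
      fun κ f hκ hf _ hfF => ?_⟩
    rw [hcoe]
    refine hκ.gagliardo_potential_le_of_eq_zero hf (by positivity) fun y hy => hfF y ?_
    rw [mul_div_cancel₀ r two_ne_zero] at hy
    exact hball hy
  · obtain ⟨r, hr, γ, hγ, hsub⟩ := exists_isometry_of_not_isCorner hp hpc
    set V := Metric.ball p (2 * r) with hV
    have hVm : MeasurableSet V := measurableSet_ball
    set C₁ : ℝ≥0 := (8 * Real.pi ^ 2 + 8).toNNReal * ((8 * √3 + 8 * A) ^ 2 / 8).toNNReal
    refine ⟨r, hr, 4 * C₁ + 4 * (ENNReal.ofReal (A / (r * √r)) ^ 2 * σ univ ^ 3).toNNReal,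
      fun κ f hκ hf hf2 _ => ?_⟩
    -- The part of `f` in the doubled ball lives on a line; the remainder vanishes on that ball.
    have hdec : f = V.indicator f + Vᶜ.indicator f := (indicator_self_add_compl V f).symm
    have hi1 : Integrable (V.indicator f) σ := hf.indicator hVm
    have hi2 : Integrable (Vᶜ.indicator f) σ := hf.indicator hVm.compl
    have hle : ∀ S : Set Plane,
        ∫⁻ x, ‖S.indicator f x‖ₑ ^ 2 ∂σ ≤ ∫⁻ x, ‖f x‖ₑ ^ 2 ∂σ := fun S => by
      refine lintegral_mono fun x => ?_
      gcongr
      exact enorm_indicator_le_enorm_self f x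
    have h1 : gagliardo (σ.restrict (Metric.ball p r)) (potential σ κ (V.indicator f)) ≤
        C₁ * ∫⁻ x, ‖f x‖ₑ ^ 2 ∂σ := by
      refine (gagliardo_mono (Measure.restrict_mono_set σ
        (Metric.ball_subset_ball (by linarith : r ≤ 2 * r))) _).trans ?_
      refine (hκ.gagliardo_potential_le_of_isometry isClosed_frontier.measurableSet hVm hγ hsub hi1
        (hf2.indicator hVm) fun y hy => indicator_of_notMem hy f).trans ?_
      rw [ENNReal.coe_mul]
      exact mul_le_mul_right (hle V) _
    have h2 : gagliardo (σ.restrict (Metric.ball p r)) (potential σ κ (Vᶜ.indicator f)) ≤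
        (ENNReal.ofReal (A / (r * √r)) ^ 2 * σ univ ^ 3).toNNReal * ∫⁻ x, ‖f x‖ₑ ^ 2 ∂σ := by
      refine (hκ.gagliardo_potential_le_of_eq_zero hi2 hr fun y hy =>
        indicator_of_notMem (not_not_intro hy) f).trans ?_
      rw [hcoe]
      exact mul_le_mul_right (hle Vᶜ) _
    have h3 : potential σ κ f = potential σ κ (V.indicator f) + potential σ κ (Vᶜ.indicator f) := by
      rw [← hκ.potential_add hi1 hi2, ← hdec]
    rw [h3]
    refine (gagliardo_add_le _ (hκ.continuous_potential hi1)).trans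
      ((add_le_add (mul_le_mul_right h1 4) (mul_le_mul_right h2 4)).trans (le_of_eq ?_))
    push_cast
    ring

/-- **The `L² → H^{1/2}` bound for localized Riesz potentials**, uniform over regularized kernels,
when the two cutoffs have no common corner in their supports. -/
theorem exists_hHalfNorm_potential_le {Ω : Set Plane} (hΩ : IsPolygonalDomain Ω)
    {χ χ' : Plane → ℝ} (hχ : ContDiff ℝ ∞ χ) (hχ' : ContDiff ℝ ∞ χ') (hs : HasCompactSupport χ)
    (hs' : HasCompactSupport χ')
    (hcorner : ∀ p, p ∈ tsupport χ → p ∈ tsupport χ' → ¬ IsCorner Ω p) (A : ℝ) :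
    ∃ C : ℝ≥0, ∀ (κ : ℝ → ℝ) (u : Plane → 𝕜), IsRieszKernel A κ → Continuous u →
      hHalfNorm (frontier Ω)
        (fun x => χ' x • potential (arcLength (frontier Ω)) κ (fun y => χ y • u y) x) ≤
        C * eLpNorm u 2 (arcLength (frontier Ω)) := by
  have := hΩ.isFiniteMeasure
  obtain ⟨M, hM⟩ := hΩ.exists_lintegral_rieszWeight_le
  set σ := arcLength (frontier Ω) with hσ
  obtain ⟨B, hB⟩ := exists_enorm_le_of_hasCompactSupport hχ.continuous hs
  obtain ⟨B', hB'⟩ := exists_enorm_le_of_hasCompactSupport hχ'.continuous hs'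
  obtain ⟨L, hL⟩ := hχ'.lipschitzWith_of_hasCompactSupport hs' (by simp)
  -- Indexing by all kernels and densities at once makes the compactness argument yield a single
  -- constant.
  let ι := {i : (ℝ → ℝ) × (Plane → 𝕜) // IsRieszKernel A i.1 ∧ Continuous i.2}
  let f : ι → Plane → 𝕜 := fun i y => χ y • i.1.2 y
  let g : ι → Plane → 𝕜 := fun i => potential σ i.1.1 (f i)
  let w : ι → Plane → 𝕜 := fun i x => χ' x • g i x
  let E : ι → ℝ≥0∞ := fun i => ∫⁻ x, ‖i.1.2 x‖ₑ ^ 2 ∂σ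
  have hfc : ∀ i, Continuous (f i) := fun i => hχ.continuous.smul i.2.2
  have hfs : ∀ i, HasCompactSupport (f i) := fun i => hs.smul_right
  have hfi : ∀ i, Integrable (f i) σ := fun i => (hfc i).integrable_of_hasCompactSupport (hfs i)
  have hf2 : ∀ i, MemLp (f i) 2 σ := fun i => (hfc i).memLp_of_hasCompactSupport (hfs i)
  have hfE : ∀ i, ∫⁻ x, ‖f i x‖ₑ ^ 2 ∂σ ≤ B ^ 2 * E i := fun i => by
    rw [← lintegral_const_mul' _ _ (by finiteness)]
    refine lintegral_mono fun x => ?_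
    rw [enorm_smul, mul_pow]
    gcongr
    exact hB x
  have hgc : ∀ i, Continuous (g i) := fun i => i.2.1.continuous_potential (hfi i)
  have hgE : ∀ i, ∫⁻ x, ‖g i x‖ₑ ^ 2 ∂σ ≤ M ^ 2 * B ^ 2 * E i := fun i => by
    refine (i.2.1.lintegral_enorm_potential_sq_le (hfi i).aestronglyMeasurable hM).trans ?_
    rw [mul_assoc]
    exact mul_le_mul_right (hfE i) _
  have hwE : ∀ i, ∫⁻ x, ‖w i x‖ₑ ^ 2 ∂σ ≤ (B' ^ 2 * (M ^ 2 * B ^ 2) : ℝ≥0) * E i := fun i => by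
    calc _ ≤ ∫⁻ x, (B' : ℝ≥0∞) ^ 2 * ‖g i x‖ₑ ^ 2 ∂σ := by
          refine lintegral_mono fun x => ?_
          simp only [w]
          rw [enorm_smul, mul_pow]
          gcongr
          exact hB' x
      _ = B' ^ 2 * ∫⁻ x, ‖g i x‖ₑ ^ 2 ∂σ := lintegral_const_mul' _ _ (by finiteness)
      _ ≤ B' ^ 2 * (M ^ 2 * B ^ 2 * E i) := mul_le_mul_right (hgE i) _
      _ = _ := by push_cast; ring
  have hloc : ∀ p ∈ frontier Ω, ∃ r > 0, ∃ C : ℝ≥0, ∀ i,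
      gagliardo (σ.restrict (Metric.ball p r)) (w i) ≤ C * E i := by
    intro p hp
    by_cases hp' : p ∈ tsupport χ'
    · have hpF : p ∉ tsupport χ ∨ ¬ IsCorner Ω p := by
        by_cases h : p ∈ tsupport χ
        · exact .inr (hcorner p h hp')
        · exact .inl h
      obtain ⟨r, hr, C, hC⟩ :=
        exists_gagliardo_potential_le (𝕜 := 𝕜) hΩ (isClosed_tsupport χ) A hp hpF
      refine ⟨r, hr, 4 * B' ^ 2 * (C * B ^ 2) +
        4 * L ^ 2 * (σ univ).toNNReal * (M ^ 2 * B ^ 2), fun i => ?_⟩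
      have h1 : gagliardo (σ.restrict (Metric.ball p r)) (g i) ≤ C * (B ^ 2 * E i) :=
        (hC _ _ i.2.1 (hfi i) (hf2 i) fun y hy => by
          simp only [f, image_eq_zero_of_notMem_tsupport hy, zero_smul]).trans
          (mul_le_mul_right (hfE i) _)
      have h2 : ∫⁻ x in Metric.ball p r, ‖g i x‖ₑ ^ 2 ∂σ ≤ M ^ 2 * B ^ 2 * E i :=
        (setLIntegral_le_lintegral _ _).trans (hgE i)
      refine (gagliardo_smul_le _ hB' hL (hgc i)).trans ?_
      calc _ ≤ 4 * (B' : ℝ≥0∞) ^ 2 * (C * (B ^ 2 * E i)) +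
            4 * L ^ 2 * σ univ * (M ^ 2 * B ^ 2 * E i) := by
            gcongr
            exact Measure.restrict_le_self
        _ = _ := by
            push_cast
            rw [ENNReal.coe_toNNReal (measure_ne_top _ _)]
            ring
    · obtain ⟨r, hr, hball⟩ := Metric.isOpen_iff.1 (isClosed_tsupport χ').isOpen_compl p hp'
      refine ⟨r, hr, 0, fun i => ?_⟩
      have hz : ∀ x ∈ Metric.ball p r, w i x = 0 := fun x hx => by
        simp only [w, image_eq_zero_of_notMem_tsupport (hball hx), zero_smul]
      refine (gagliardo_restrict_le_of_lipschitz σ (c := 0) fun x hx y hy => ?_).trans (by simp)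
      simp [hz x hx, hz y hy]
  obtain ⟨C, hC⟩ := exists_gagliardo_le_of_local σ hΩ.isCompact_frontier
    (by simp [hσ, arcLength, isClosed_frontier.measurableSet.compl])
    (fun i => hχ'.continuous.smul (hgc i)) hwE hloc
  set C₂ : ℝ≥0 := B' ^ 2 * (M ^ 2 * B ^ 2) + C
  refine ⟨C₂ ^ (1 / 2 : ℝ), fun κ u hκ hu => ?_⟩
  have hsum : eLpNorm (w ⟨(κ, u), hκ, hu⟩) 2 σ ^ 2 +
      hHalfSeminormSq (frontier Ω) (w ⟨(κ, u), hκ, hu⟩) ≤ C₂ * eLpNorm u 2 σ ^ 2 := by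
    rw [eLpNorm_two_sq, eLpNorm_two_sq, ENNReal.coe_add, add_mul]
    exact add_le_add (hwE _) (hC _)
  calc _ ≤ (C₂ * eLpNorm u 2 σ ^ 2) ^ (1 / 2 : ℝ) := ENNReal.rpow_le_rpow hsum (by norm_num)
    _ = _ := by
        rw [ENNReal.mul_rpow_of_nonneg _ _ (by norm_num), ← ENNReal.rpow_natCast,
          ← ENNReal.rpow_mul, ENNReal.coe_rpow_of_nonneg _ (by norm_num)]
        simp

theorem hHalfNorm_zero (Γ : Set Plane) : hHalfNorm Γ (0 : Plane → 𝕜) = 0 := by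
  simp [hHalfNorm, hHalfSeminormSq]

theorem memHHalf_of_contDiff {Γ : Set Plane} {w : Plane → 𝕜} (hw : ContDiff ℝ ∞ w) :
    MemHHalf Γ w :=
  ⟨hw.continuous.aestronglyMeasurable, fun ε hε => ⟨w, hw, by rwa [sub_self, hHalfNorm_zero]⟩⟩

theorem enorm_integral_mul_le {Γ : Set Plane} {v w : Plane → 𝕜} (hw : ContDiff ℝ ∞ w)
    (hfin : hHalfNorm Γ w ≠ ⊤) :
    ‖∫ x, v x * w x ∂arcLength Γ‖ₑ ≤ hHalfNorm Γ w * hMinusHalfNorm Γ v := by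
  -- The supremum omits functions of norm zero; such `w` vanishes almost everywhere, so the pairing
  -- is zero.
  by_cases h0 : hHalfNorm Γ w = 0
  · have h1 : eLpNorm w 2 (arcLength Γ) = 0 := by
      rw [hHalfNorm, ENNReal.rpow_eq_zero_iff_of_pos (by norm_num), add_eq_zero] at h0
      exact pow_eq_zero_iff two_ne_zero |>.1 h0.1
    rw [eLpNorm_eq_zero_iff hw.continuous.aestronglyMeasurable two_ne_zero] at h1
    have h2 : ∫ x, v x * w x ∂arcLength Γ = 0 :=
      integral_eq_zero_of_ae (by filter_upwards [h1] with x hx; simp [hx])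
    simp [h2]
  · rw [mul_comm, ← ENNReal.div_le_iff h0 hfin]
    exact le_iSup_of_le w (le_iSup_of_le (memHHalf_of_contDiff hw) (le_iSup_of_le h0 le_rfl))

end Bounds

/-! ### The Riesz pairing as a limit of regularized pairings -/

section Pairing

variable {𝕜 : Type*} [RCLike 𝕜] {Ω : Set Plane}

theorem ae_prod_ne {X : Type*} [MetricSpace X] [MeasurableSpace X] [BorelSpace X]
    [SecondCountableTopology X] (μ : Measure X) [SFinite μ] [NullSingletonClass μ] :
    ∀ᵐ p ∂μ.prod μ, p.1 ≠ p.2 := by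
  rw [ae_iff, Measure.measure_prod_null]
  · refine .of_forall fun x => ?_
    have : Prod.mk x ⁻¹' {a : X × X | ¬ a.1 ≠ a.2} = {x} := by
      ext y; simp [eq_comm]
    simp only [this, measure_singleton, Pi.zero_apply]
  · simp only [ne_eq, not_not]
    exact measurableSet_eq_fun measurable_fst measurable_snd

theorem IsPolygonalDomain.integrable_inv_sqrt_dist (hΩ : IsPolygonalDomain Ω) :
    Integrable (fun p : Plane × Plane => (√(dist p.1 p.2))⁻¹)
      ((arcLength (frontier Ω)).prod (arcLength (frontier Ω))) := by
  have := hΩ.isFiniteMeasure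
  obtain ⟨M, hM⟩ := hΩ.exists_lintegral_rieszWeight_le
  have hm : Measurable fun p : Plane × Plane => (√(dist p.1 p.2))⁻¹ := by fun_prop
  refine ⟨hm.aestronglyMeasurable, ?_⟩
  rw [HasFiniteIntegral, lintegral_prod _ hm.enorm.aemeasurable]
  calc _ ≤ ∫⁻ _, (M : ℝ≥0∞) ∂arcLength (frontier Ω) := by
        refine lintegral_mono fun x => (lintegral_mono fun y => ?_).trans (hM x)
        rw [Real.enorm_of_nonneg (by positivity)]
        exact ofReal_inv_sqrt_dist_le x y
    _ < _ := by
        rw [lintegral_const]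
        finiteness

theorem IsPolygonalDomain.integrable_rieszIntegrand (hΩ : IsPolygonalDomain Ω) {f g : Plane → 𝕜}
    (hf : Continuous f) (hfs : HasCompactSupport f) (hg : Continuous g)
    (hgs : HasCompactSupport g) :
    Integrable (rieszIntegrand f g)
      ((arcLength (frontier Ω)).prod (arcLength (frontier Ω))) := by
  obtain ⟨B, hB⟩ := hfs.exists_bound_of_continuous hf
  obtain ⟨B', hB'⟩ := hgs.exists_bound_of_continuous hg
  have hc : Continuous fun p : Plane × Plane => f p.2 * g p.1 := by fun_prop
  refine hΩ.integrable_inv_sqrt_dist.smul_of_top_left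
    (memLp_top_of_bound hc.aestronglyMeasurable (B * B') (.of_forall fun p => ?_))
  rw [norm_mul]
  have := (norm_nonneg _).trans (hB p.2)
  gcongr
  · exact hB _
  · exact hB' _

theorem integral_prod_kernel_smul {X : Type*} [MetricSpace X] [MeasurableSpace X] [BorelSpace X]
    [SecondCountableTopology X] {μ : Measure X} [SFinite μ] {A : ℝ} {κ : ℝ → ℝ}
    (hκ : IsRieszKernel A κ) {f g : X → 𝕜} (hf : Integrable f μ) (hg : Integrable g μ) :
    ∫ p, κ (dist p.1 p.2) • (f p.2 * g p.1) ∂(μ.prod μ) = ∫ x, g x * potential μ κ f x ∂μ := by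
  obtain ⟨B, hB⟩ := hκ.exists_bound
  have hc := hκ.continuous
  have hi : Integrable (fun p : X × X => κ (dist p.1 p.2) • (f p.2 * g p.1)) (μ.prod μ) := by
    refine Integrable.bdd_smul (f := fun p : X × X => f p.2 * g p.1) ?_ B
      (by fun_prop : Continuous fun p : X × X => κ (dist p.1 p.2)).aestronglyMeasurable
      (.of_forall fun p => hB _ dist_nonneg)
    simpa only [mul_comm] using hg.mul_prod hf
  rw [integral_prod _ hi]
  refine integral_congr_ae (.of_forall fun x => ?_)
  simp only [potential]
  rw [← integral_const_mul]
  refine integral_congr_ae (.of_forall fun y => ?_)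
  simp only [mul_smul_comm, mul_comm]

/-- Dominated convergence: off the diagonal, which is a null set, every regularized kernel is at
most `r^{-1/2}`, and `ρ` bounds all distances on the boundary, so the cutoff equals one there. -/
theorem IsPolygonalDomain.tendsto_regularized_pairing (hΩ : IsPolygonalDomain Ω) {f g : Plane → 𝕜}
    (hf : Continuous f) (hfs : HasCompactSupport f) (hg : Continuous g)
    (hgs : HasCompactSupport g) {ρ : ℝ} (hρ : 0 < ρ)
    (hdist : ∀ x ∈ frontier Ω, ∀ y ∈ frontier Ω, dist x y ≤ ρ) :
    Filter.Tendsto (fun n : ℕ => ∫ x, g x * potential (arcLength (frontier Ω))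
        (regularizedKernel ρ (1 / ((n : ℝ) + 1))) f x ∂arcLength (frontier Ω))
      Filter.atTop (nhds (rieszPairing (frontier Ω) f g)) := by
  have := hΩ.isFiniteMeasure
  have : NullSingletonClass (μH[1] : Measure Plane) := Measure.nullSingletonClass_hausdorff _ one_pos
  have : NullSingletonClass (arcLength (frontier Ω)) :=
    inferInstanceAs (NullSingletonClass ((μH[1]).restrict (frontier Ω)))
  obtain ⟨L, hL⟩ := exists_lipschitzWith_radialCutoff hρ
  have hκ : ∀ n : ℕ, IsRieszKernel _ (regularizedKernel ρ (1 / ((n : ℝ) + 1))) := fun n =>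
    isRieszKernel_regularizedKernel hρ (by positivity) hL
  have hne := ae_prod_ne (arcLength (frontier Ω))
  have hmem : ∀ᵐ x ∂arcLength (frontier Ω), x ∈ frontier Ω :=
    ae_restrict_mem isClosed_frontier.measurableSet
  simp_rw [← integral_prod_kernel_smul (hκ _) (hf.integrable_of_hasCompactSupport hfs)
    (hg.integrable_of_hasCompactSupport hgs)]
  refine tendsto_integral_of_dominated_convergence (fun p => ‖rieszIntegrand f g p‖)
    (fun n => ?_) (hΩ.integrable_rieszIntegrand hf hfs hg hgs).norm (fun n => ?_) ?_
  · have := (hκ n).continuous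
    exact Continuous.aestronglyMeasurable (by fun_prop)
  · filter_upwards [hne] with p hp
    rw [rieszIntegrand, norm_smul, norm_smul]
    gcongr
    rw [Real.norm_eq_abs, Real.norm_of_nonneg (by positivity)]
    exact (hκ n).abs_le _ (dist_pos.2 hp)
  · filter_upwards [hne, Measure.quasiMeasurePreserving_fst.ae hmem,
      Measure.quasiMeasurePreserving_snd.ae hmem] with p hp hp1 hp2
    exact (tendsto_regularizedKernel hρ (dist_pos.2 hp) (hdist _ hp1 _ hp2)).smul_const _

end Pairing

end RieszPolygon

/-! ### The duality argument -/

theorem mainTheorem4 {𝕜 : Type*} [RCLike 𝕜]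
    (Ω : Set RieszPolygon.Plane) (hΩ : RieszPolygon.IsPolygonalDomain Ω)
    (P : Finset RieszPolygon.Disk) (hP : RieszPolygon.IsDiskCover Ω P)
    (χ : RieszPolygon.Disk → RieszPolygon.Plane → ℝ)
    (hχ : RieszPolygon.IsDiskPartition Ω P χ)
    (D D' : RieszPolygon.Disk) (hD : D ∈ P) (hD' : D' ∈ P)
    (hDD' : D ≠ D' ∨ (D = D' ∧ ¬ RieszPolygon.IsCorner Ω D.centre)) :
    ∃ C : ℝ≥0, ∀ u v : RieszPolygon.Plane → 𝕜, ContDiff ℝ ∞ u → ContDiff ℝ ∞ v →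
      Integrable
        (RieszPolygon.rieszIntegrand (fun y => χ D y • u y) (fun x => χ D' x • v x))
        ((RieszPolygon.arcLength (frontier Ω)).prod (RieszPolygon.arcLength (frontier Ω))) ∧
      ‖RieszPolygon.rieszPairing (frontier Ω)
          (fun y => χ D y • u y) (fun x => χ D' x • v x)‖ₑ ≤
        C * eLpNorm u 2 (RieszPolygon.arcLength (frontier Ω)) *
          RieszPolygon.hMinusHalfNorm (frontier Ω) v := by
  have hcpt : ∀ D ∈ P, HasCompactSupport (χ D) := fun D hD =>
    (isCompact_closedBall D.centre D.radius).of_isClosed_subset (isClosed_tsupport _)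
      ((hχ.tsupport_subset D hD).trans Metric.ball_subset_closedBall)
  obtain ⟨R, hR⟩ := Metric.isBounded_iff.1 hΩ.isCompact_frontier.isBounded
  set ρ : ℝ := max R 1
  have hρ : 0 < ρ := lt_max_of_lt_right one_pos
  obtain ⟨L, hL⟩ := RieszPolygon.exists_lipschitzWith_radialCutoff hρ
  obtain ⟨C, hC⟩ := RieszPolygon.exists_hHalfNorm_potential_le (𝕜 := 𝕜) hΩ (hχ.smooth D hD)
    (hχ.smooth D' hD') (hcpt D hD) (hcpt D' hD')
    (fun p hp hp' => hP.not_isCorner hD hD' hDD' (hχ.tsupport_subset D hD hp)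
      (hχ.tsupport_subset D' hD' hp')) (1 + 2 * ρ * L)
  refine ⟨C, fun u v hu hv => ?_⟩
  have := hΩ.isFiniteMeasure
  have hfc : Continuous fun y => χ D y • u y := (hχ.smooth D hD).continuous.smul hu.continuous
  have hfs : HasCompactSupport fun y => χ D y • u y := (hcpt D hD).smul_right
  have hgc : Continuous fun x => χ D' x • v x := (hχ.smooth D' hD').continuous.smul hv.continuous
  have hgs : HasCompactSupport fun x => χ D' x • v x := (hcpt D' hD').smul_right
  refine ⟨hΩ.integrable_rieszIntegrand hfc hfs hgc hgs, ?_⟩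
  -- The bound is closed under limits, so it is enough to prove it for each regularized pairing with
  -- `C` independent of `n`.
  refine le_of_tendsto (hΩ.tendsto_regularized_pairing hfc hfs hgc hgs hρ
    fun x hx y hy => (hR hx hy).trans (le_max_left _ _)).enorm (.of_forall fun n => ?_)
  have hn : (0 : ℝ) < 1 / ((n : ℝ) + 1) := by positivity
  -- The cutoff `χ D'` is moved from `v` to the potential, which makes a smooth test function
  -- against `v`.
  have hw := (hχ.smooth D' hD').smul (RieszPolygon.contDiff_potential_regularizedKernel
    (μ := RieszPolygon.arcLength (frontier Ω)) hfc.locallyIntegrable hρ hn)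
  have hle := hC _ u (RieszPolygon.isRieszKernel_regularizedKernel hρ hn hL) hu.continuous
  have hu2 : MemLp u 2 (RieszPolygon.arcLength (frontier Ω)) := by
    obtain ⟨B, hB⟩ := hΩ.isCompact_frontier.exists_bound_of_continuousOn hu.continuous.continuousOn
    refine MemLp.of_bound hu.continuous.aestronglyMeasurable B ?_
    filter_upwards [ae_restrict_mem isClosed_frontier.measurableSet] with x hx using hB x hx
  have htop : C * eLpNorm u 2 (RieszPolygon.arcLength (frontier Ω)) ≠ ⊤ :=
    ENNReal.mul_ne_top ENNReal.coe_ne_top hu2.2.ne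
  have hb := RieszPolygon.enorm_integral_mul_le (Γ := frontier Ω) (v := v) hw
    (ne_top_of_le_ne_top htop hle)
  refine le_trans (le_of_eq ?_) (hb.trans (mul_le_mul_left hle _))
  congr 1
  refine integral_congr_ae (.of_forall fun x => ?_)
  simp only [smul_mul_assoc, Pi.smul_apply', mul_smul_comm]
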